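/- **Setting.** Let $L\ge 2$, let $\xi_1,\dots,\xi_m\in\mathbb R^d$ be distinct training inputs with labels $y_1,\dots,y_m\in\mathbb R$, let $\phi:\mathbb R\to\mathbb R$ be an activation, $\mathcal L(z,y)$ a loss that is continuously differentiable in the prediction $z$ (with derivative $\mathcal L'$ in $z$), $\eta>0$ a learning rate, and $\mathcal B_t\subseteq[m]$ ($t=0,1,2,\dots$) mini-batches. The infinite-width $L$-hidden-layer perceptron trained by SGD in the maximal update parametrization is the following system of random variables. $Z^{W_0^1}$ is standard Gaussian in $\mathbb R^d$ and $Z^{\widehat W_0^{L+1}}$ standard Gaussian in $\mathbb R$. With the error signals $\mathring\chi_{t,i}=\mathcal L'(\mathring f_t(\xi_i),y_i)\,\mathbf 1\{i\in\mathcal B_t\}$, for every training input $\xi$ and $t\ge 0$: * $Z^{h_t^1(\xi)}=\langle Z^{W_0^1},\xi\rangle-\eta\sum_{s<t}\sum_j\mathring\chi_{s,j}\langle\xi_j,\xi\rangle Z^{dh_s^1(\xi_j)}$, and $Z^{x_t^l(\xi)}=\phi(Z^{h_t^l(\xi)})$ for $1\le l\le L$; * for $2\le l\le L$, $Z^{h_t^l(\xi)}=\hat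 Z^{W_0^lx_t^{l-1}(\xi)}+\sum_j\sum_{s<t}Z^{dh_s^l(\xi_j)}\,\mathbb E\frac{\partial Z^{x_t^{l-1}(\xi)}}{\partial\hat Z^{W_0^{l\top}dh_s^l(\xi_j)}}-\eta\sum_{s<t}\sum_j\mathring\chi_{s,j}Z^{dh_s^l(\xi_j)}\,\mathbb E[Z^{x_s^{l-1}(\xi_j)}Z^{x_t^{l-1}(\xi)}]$; * $Z^{\widehat W_t^{L+1}}=Z^{\widehat W_0^{L+1}}-\eta\sum_{s<t}\sum_j\mathring\chi_{s,j}Z^{x_s^L(\xi_j)}$; $\mathring f_0=0$ and $\mathring f_{t+1}(\xi)=\mathring f_t(\xi)+\mathbb E\big[(Z^{\widehat W_{t+1}^{L+1}}-Z^{\widehat W_t^{L+1}})Z^{x_{t+1}^L(\xi)}\big]+\mathbb E\big[Z^{\widehat W_t^{L+1}}(Z^{x_{t+1}^L(\xi)}-Z^{x_t^L(\xi)})\big]$; * $Z^{dx_t^L(\xi)}=Z^{\widehat W_t^{L+1}}$, $Z^{dh_t^l(\xi)}=Z^{dx_t^l(\xi)}\phi'(Z^{h_t^l(\xi)})$, and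 for $2\le l\le L$, $Z^{dx_t^{l-1}(\xi)}=\hat Z^{W_0^{l\top}dh_t^l(\xi)}+\sum_j\sum_{s\le t}Z^{x_s^{l-1}(\xi_j)}\,\mathbb E\frac{\partial Z^{dh_t^l(\xi)}}{\partial\hat Z^{W_0^lx_s^{l-1}(\xi_j)}}-\eta\sum_{s<t}\sum_j\mathring\chi_{s,j}Z^{x_s^{l-1}(\xi_j)}\,\mathbb E[Z^{dh_s^l(\xi_j)}Z^{dh_t^l(\xi)}]$. Here, for each $l$, $\{\hat Z^{W_0^lx_t^{l-1}(\xi_i)}\}_{t,i}$ and $\{\hat Z^{W_0^{l\top}dh_t^l(\xi_i)}\}_{t,i}$ are centred jointly Gaussian families with covariances $\mathbb E[Z^{x_t^{l-1}(\xi_i)}Z^{x_s^{l-1}(\xi_j)}]$ and $\mathbb E[Z^{dh_t^l(\xi_i)}Z^{dh_s^l(\xi_j)}]$; all these families, $Z^{W_0^1}$ and $Z^{\widehat W_0^{L+1}}$ are independent; and partial derivatives are taken of the $Z$'s as functions of these Gaussian variables and the initial weights, given by the recursion. **Assumptions.** (i) For three distinct training inputs, $|\langle\xi_i,\xi_j\rangle|\ne|\langle\xi_i,\xi_k\rangle|$;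 for two distinct ones, $\langle\xi_i,\xi_j\rangle\ne 0$; and no training input is the negative of a training input, i.e. none is zero and no two are opposite (this last condition is automatic if $m\ge 3$). (ii) $\phi\in C^2$ with $\phi',\phi''$ bounded; all level sets of $\phi$ and of $\phi'$ are countable; for all finite families of reals with $|b_i|\ne|b_j|$ for $i\neq j$ and $a_kb_k\ne0$ for some $k$, the function $\sum_i a_i\phi(b_ix+c_i)$ is not constant; and for all $r_1,r_2\in\mathbb R$ the function $(r_1+\phi)(r_2+\phi')$ is not almost everywhere constant. **Claim.** Suppose the weights of the infinite-width model do not change from time $T$ on: for all $t\ge T$, almost surely, the input weights $Z^{W_0^1}-\eta\sum_{s<t}\sum_j\mathring\chi_{s,j}Z^{dh_s^1(\xi_j)}\xi_j$, the displacements $-\eta\sum_{s<t}\sum_j\mathring\chi_{s,j}Z^{dh_s^l(\xi_j)}\otimes Z^{x_s^{l-1}(\xi_j)}$ of the hidden weights ($2\le l\le L$; the two factors taken on independent copies, one per neuron of layer $l$ and of layer $l-1$) and the output weight $Z^{\widehat W_t^{L+1}}$ equal their values at time $T$. Then the error signal vanishes for every sample of every later mini-batch: for all $i\in\bigcup_{t\ge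 T}\mathcal B_t$, $$\mathring\chi_{T,i}=0,\qquad \mathcal L'(\mathring f_T(\xi_i),y_i)=0,\qquad \mathring\chi_{t,i}=0\ \text{ for all } t\ge T.$$ In particular, if $\mathcal L(\cdot,y_i)$ is convex, $\mathring f_T(\xi_i)$ is a global minimizer of $\mathcal L(\cdot,y_i)$. -/

import Mathlib

open MeasureTheory ProbabilityTheory
open scoped BigOperators

noncomputable section

/-- Data of the training of an `L`-hidden-layer perceptron with scalar output by mini-batch SGD:
`m` training inputs `ξ i` in `ℝ^d` with labels `y i`, the activation `φ`, the loss `loss z y` of the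
prediction `z` for the label `y`, the base learning rate `η` and the mini-batch `batch t` used in
step `t`. -/
structure MLPTraining where
  L : ℕ
  d : ℕ
  m : ℕ
  ξ : Fin m → EuclideanSpace ℝ (Fin d)
  y : Fin m → ℝ
  φ : ℝ → ℝ
  loss : ℝ → ℝ → ℝ
  η : ℝ
  batch : ℕ → Finset (Fin m)

/-- The primitive random variables of one layer, as formal variables `ω`:
* `inW ω`: a row of the initial input matrix `W^1_0` (occurs in layer `1` only);
* `outW ω`: the initial (rescaled) output weight `Ŵ_0^{L+1}` (occurs in layer `L` only);
* `fwd ω s i`: the Gaussian `Ẑ^{W_0^l x_s^{l-1}(ξ_i)}` (layers `l ≥ 2`);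
* `bwd ω s i`: the Gaussian `Ẑ^{W_0^{l+1,⊤} dh_s^{l+1}(ξ_i)}` (layers `l < L`). -/
abbrev Noise (d m : ℕ) : Type :=
  EuclideanSpace ℝ (Fin d) × ℝ × (ℕ → Fin m → ℝ) × (ℕ → Fin m → ℝ)

namespace Noise

variable {d m : ℕ}

def inW (ω : Noise d m) : EuclideanSpace ℝ (Fin d) := ω.1
def outW (ω : Noise d m) : ℝ := ω.2.1
def fwd (ω : Noise d m) : ℕ → Fin m → ℝ := ω.2.2.1
def bwd (ω : Noise d m) : ℕ → Fin m → ℝ := ω.2.2.2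

/-- Partial derivative of `F` with respect to the formal variable `fwd s j`. -/
def pderivFwd (s : ℕ) (j : Fin m) (F : Noise d m → ℝ) (ω : Noise d m) : ℝ :=
  deriv (fun c : ℝ =>
    F (ω.1, ω.2.1, Function.update ω.fwd s (Function.update (ω.fwd s) j c), ω.2.2.2)) (ω.fwd s j)

/-- Partial derivative of `F` with respect to the formal variable `bwd s j`. -/
def pderivBwd (s : ℕ) (j : Fin m) (F : Noise d m → ℝ) (ω : Noise d m) : ℝ :=
  deriv (fun c : ℝ =>
    F (ω.1, ω.2.1, ω.2.2.1, Function.update ω.bwd s (Function.update (ω.bwd s) j c))) (ω.bwd s j)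

end Noise

/-- Law of a centred Gaussian family `(z s i)`, `s < p`, with covariance `K`; the entries with
`s ≥ p`, which have not been generated yet, are put equal to `0`. -/
def gaussianFamily {m : ℕ} (p : ℕ) (K : Fin p → Fin m → Fin p → Fin m → ℝ) :
    Measure (ℕ → Fin m → ℝ) :=
  (multivariateGaussian 0
      (Matrix.of fun a b : Fin p × Fin m => K a.1 a.2 b.1 b.2)).map
    (fun z s i => if h : s < p then z (⟨s, h⟩, i) else 0)

/-- Law of the primitive random variables of one layer: `inW` is standard Gaussian in `ℝ^d`, `outW`
is standard Gaussian in `ℝ`, the families `fwd` (for times `< p`) and `bwd` (for times `< q`) are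
centred Gaussian with covariances `Kf` and `Kb`, and the four are independent. -/
def layerLaw {d m : ℕ} {p q : ℕ} (Kf : Fin p → Fin m → Fin p → Fin m → ℝ)
    (Kb : Fin q → Fin m → Fin q → Fin m → ℝ) : Measure (Noise d m) :=
  (stdGaussian (EuclideanSpace ℝ (Fin d))).prod
    ((gaussianReal 0 1).prod ((gaussianFamily p Kf).prod (gaussianFamily q Kb)))

namespace MLPTraining

/-! The infinite-width limit under the maximal update parametrization, by simultaneous recursion
on the time `t`, the direction (forward, then backward) and the layer `l ∈ {1, …, L}`. -/

mutual

/-- `Z^{h_t^l(ξ_i)}`. In layer `1` this is `⟪W^1_t, ξ_i⟫`. For `l ≥ 2` it is the sum of the Gaussian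
`Ẑ^{W_0^l x_t^{l-1}(ξ_i)}`, of `Ż^{W_0^l x_t^{l-1}(ξ_i)}`, and of the contribution of the updates
of `W^l` made before time `t`. -/
def h (M : MLPTraining) (l t : ℕ) (i : Fin M.m) (ω : Noise M.d M.m) : ℝ :=
  if _hl : 2 ≤ l then
    ω.fwd t i
      + ∑ j : Fin M.m, ∑ s : Fin t, M.dh l s j ω * M.meanPderivX (l - 1) t i s j
      - M.η * ∑ s : Fin t, ∑ j : Fin M.m,
          M.χ s j * M.dh l s j ω * M.gramX (l - 1) s j t i
  else
    inner ℝ ω.inW (M.ξ i)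
      - M.η * ∑ s : Fin t, ∑ j : Fin M.m, M.χ s j * inner ℝ (M.ξ j) (M.ξ i) * M.dh l s j ω
termination_by (t, 0, l, 0)
decreasing_by
  all_goals simp only [Prod.lex_def, true_and]
  all_goals omega

/-- `Z^{x_t^l(ξ_i)}`. -/
def x (M : MLPTraining) (l t : ℕ) (i : Fin M.m) (ω : Noise M.d M.m) : ℝ :=
  M.φ (M.h l t i ω)
termination_by (t, 0, l, 1)
decreasing_by
  all_goals simp only [Prod.lex_def, true_and]
  all_goals omega

/-- `𝔼 Z^{x_s^l(ξ_i)} Z^{x_r^l(ξ_j)}`. -/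
def gramX (M : MLPTraining) (l s : ℕ) (i : Fin M.m) (r : ℕ) (j : Fin M.m) : ℝ :=
  ∫ ω, M.x l s i ω * M.x l r j ω ∂(layerLaw (p := max s r + 1) (q := max s r)
    (fun a i' b j' => if _hl : 2 ≤ l then M.gramX (l - 1) a i' b j' else 0)
    (fun a i' b j' => if _hl : l < M.L then M.gramDH (l + 1) a i' b j' else 0))
termination_by (max s r, 0, l, 2)
decreasing_by
  all_goals simp only [Prod.lex_def, true_and]
  all_goals omega

/-- `𝔼 ∂ Z^{x_t^l(ξ_i)} / ∂ Ẑ^{W_0^{l+1,⊤} dh_s^{l+1}(ξ_j)}`. -/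
def meanPderivX (M : MLPTraining) (l t : ℕ) (i : Fin M.m) (s : ℕ) (j : Fin M.m) : ℝ :=
  ∫ ω, Noise.pderivBwd s j (M.x l t i) ω ∂(layerLaw (p := t + 1) (q := t)
    (fun a i' b j' => if _hl : 2 ≤ l then M.gramX (l - 1) a i' b j' else 0)
    (fun a i' b j' => if _hl : l < M.L then M.gramDH (l + 1) a i' b j' else 0))
termination_by (t, 0, l, 3)
decreasing_by
  all_goals simp only [Prod.lex_def, true_and]
  all_goals omega

/-- `Z^{Ŵ_t^{L+1}}`. -/
def outWeight (M : MLPTraining) (t : ℕ) (ω : Noise M.d M.m) : ℝ :=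
  ω.outW - M.η * ∑ s : Fin t, ∑ i : Fin M.m, M.χ s i * M.x M.L s i ω
termination_by (t, 0, 0, 0)
decreasing_by
  all_goals simp only [Prod.lex_def, true_and]
  all_goals omega

/-- The limiting output `f̊_t(ξ_i) = δf̊_1(ξ_i) + ⋯ + δf̊_t(ξ_i)`, where `δf̊_t(ξ)` is
`𝔼 Z^{δW_t^{L+1}} Z^{x_t^L(ξ)} + 𝔼 Z^{Ŵ_{t-1}^{L+1}} Z^{δx_t^L(ξ)}`. -/
def f (M : MLPTraining) (t : ℕ) (i : Fin M.m) : ℝ :=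
  match t with
  | 0 => 0
  | t + 1 => M.f t i
      + ∫ ω, ((M.outWeight (t + 1) ω - M.outWeight t ω) * M.x M.L (t + 1) i ω
          + M.outWeight t ω * (M.x M.L (t + 1) i ω - M.x M.L t i ω))
        ∂(layerLaw (p := t + 2) (q := t + 1)
          (fun a i' b j' => if _hl : 2 ≤ M.L then M.gramX (M.L - 1) a i' b j' else 0)
          (fun _ _ _ _ => 0))
termination_by (t, 1, 0, 0)
decreasing_by
  all_goals simp only [Prod.lex_def, true_and]
  all_goals omega

/-- The error signal `χ̊_{t,i} = ∂₁ loss (f̊_t(ξ_i), y_i) · 𝟙{i ∈ B_t}`. -/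
def χ (M : MLPTraining) (t : ℕ) (i : Fin M.m) : ℝ :=
  if i ∈ M.batch t then deriv (fun z => M.loss z (M.y i)) (M.f t i) else 0
termination_by (t, 1, 0, 1)
decreasing_by
  all_goals simp only [Prod.lex_def, true_and]
  all_goals omega

/-- `Z^{dx_t^l(ξ_i)}`. For `l = L` this is `Z^{Ŵ_t^{L+1}}`. For `l < L` it is the sum of the Gaussian
`Ẑ^{W_0^{l+1,⊤} dh_t^{l+1}(ξ_i)}`, of `Ż^{W_0^{l+1,⊤} dh_t^{l+1}(ξ_i)}`, and of the contribution of
the updates of `W^{l+1}` made before time `t`. The sum in `Ż` runs over all forward variables on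
which `dh_t^{l+1}` may depend. -/
def dx (M : MLPTraining) (l t : ℕ) (i : Fin M.m) (ω : Noise M.d M.m) : ℝ :=
  if _hl : l < M.L then
    ω.bwd t i
      + ∑ j : Fin M.m, ∑ s : Fin (t + 1), M.x l s j ω * M.meanPderivDH (l + 1) t i s j
      - M.η * ∑ s : Fin t, ∑ j : Fin M.m,
          M.χ s j * M.x l s j ω * M.gramDH (l + 1) s j t i
  else M.outWeight t ω
termination_by (t, 2, M.L - l, 0)
decreasing_by
  all_goals simp only [Prod.lex_def, true_and]
  all_goals omega

/-- `Z^{dh_t^l(ξ_i)}`. -/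
def dh (M : MLPTraining) (l t : ℕ) (i : Fin M.m) (ω : Noise M.d M.m) : ℝ :=
  M.dx l t i ω * deriv M.φ (M.h l t i ω)
termination_by (t, 2, M.L - l, 1)
decreasing_by
  all_goals simp only [Prod.lex_def, true_and]
  all_goals omega

/-- `𝔼 Z^{dh_s^l(ξ_i)} Z^{dh_r^l(ξ_j)}`. -/
def gramDH (M : MLPTraining) (l s : ℕ) (i : Fin M.m) (r : ℕ) (j : Fin M.m) : ℝ :=
  ∫ ω, M.dh l s i ω * M.dh l r j ω ∂(layerLaw (p := max s r + 1) (q := max s r + 1)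
    (fun a i' b j' => if _hl : 2 ≤ l then M.gramX (l - 1) a i' b j' else 0)
    (fun a i' b j' => if _hl : l < M.L then M.gramDH (l + 1) a i' b j' else 0))
termination_by (max s r, 2, M.L - l, 2)
decreasing_by
  all_goals simp only [Prod.lex_def, true_and]
  all_goals omega

/-- `𝔼 ∂ Z^{dh_t^l(ξ_i)} / ∂ Ẑ^{W_0^l x_s^{l-1}(ξ_j)}`. -/
def meanPderivDH (M : MLPTraining) (l t : ℕ) (i : Fin M.m) (s : ℕ) (j : Fin M.m) : ℝ :=
  ∫ ω, Noise.pderivFwd s j (M.dh l t i) ω ∂(layerLaw (p := t + 1) (q := t + 1)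
    (fun a i' b j' => if _hl : 2 ≤ l then M.gramX (l - 1) a i' b j' else 0)
    (fun a i' b j' => if _hl : l < M.L then M.gramDH (l + 1) a i' b j' else 0))
termination_by (t, 2, M.L - l, 3)
decreasing_by
  all_goals simp only [Prod.lex_def, true_and]
  all_goals omega

end

/-- Law of the primitive random variables of layer `l`, with the forward Gaussians of times `< p` and
the backward Gaussians of times `< q`. -/
def law (M : MLPTraining) (l p q : ℕ) : Measure (Noise M.d M.m) :=
  layerLaw (p := p) (q := q)
    (fun a i b j => if 2 ≤ l then M.gramX (l - 1) a i b j else 0)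
    (fun a i b j => if l < M.L then M.gramDH (l + 1) a i b j else 0)

/-- A row of the input matrix `W^1_t` at time `t`, as a random vector. -/
def inWeight (M : MLPTraining) (t : ℕ) (ω : Noise M.d M.m) : EuclideanSpace ℝ (Fin M.d) :=
  ω.inW - M.η • ∑ s : Fin t, ∑ j : Fin M.m, (M.χ s j * M.dh 1 s j ω) • M.ξ j

/-- The displacement `W^l_t - W^l_0` of a hidden weight matrix, `2 ≤ l ≤ L`: the limit of `n` times
its `(α, β)` entry, where `ω` belongs to the neuron `α` of layer `l` and `ω'` to the neuron `β` of
layer `l - 1`. -/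
def hiddenDisplacement (M : MLPTraining) (l t : ℕ) (ω ω' : Noise M.d M.m) : ℝ :=
  -M.η * ∑ s : Fin t, ∑ j : Fin M.m, M.χ s j * M.dh l s j ω * M.x (l - 1) s j ω'

/-- All weights of the infinite-width model stay what they are at time `T` from then on. -/
def WeightsConstantFrom (M : MLPTraining) (T : ℕ) : Prop :=
  ∀ t, T ≤ t →
    (∀ᵐ ω ∂(M.law 1 t t), M.inWeight t ω = M.inWeight T ω) ∧
    (∀ l, 2 ≤ l → l ≤ M.L → ∀ᵐ ω ∂((M.law l t t).prod (M.law (l - 1) t t)),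
      M.hiddenDisplacement l t ω.1 ω.2 = M.hiddenDisplacement l T ω.1 ω.2) ∧
    (∀ᵐ ω ∂(M.law M.L t t), M.outWeight t ω = M.outWeight T ω)

end MLPTraining

/-- Non-degeneracy of the activation: nontrivial combinations of rescaled and shifted copies of `φ`
with scales of pairwise distinct modulus are not constant, and `(r₁ + φ) (r₂ + φ')` is never a.e.
constant. -/
structure GoodFunction (φ : ℝ → ℝ) : Prop where
  comb_not_const : ∀ (n : ℕ) (a b c : Fin n → ℝ), (∃ k, a k * b k ≠ 0) →
    (∀ i j, i ≠ j → |b i| ≠ |b j|) → ¬ ∃ C : ℝ, ∀ z : ℝ, ∑ i, a i * φ (b i * z + c i) = C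
  prod_not_const : ∀ r₁ r₂ : ℝ, ¬ ∃ C : ℝ, ∀ᵐ z : ℝ, (r₁ + φ z) * (r₂ + deriv φ z) = C

structure GoodActivation (φ : ℝ → ℝ) : Prop where
  contDiff : ContDiff ℝ 2 φ
  deriv_bounded : ∃ C : ℝ, ∀ z, |deriv φ z| ≤ C
  deriv2_bounded : ∃ C : ℝ, ∀ z, |deriv (deriv φ) z| ≤ C
  good : GoodFunction φ
  level_countable : ∀ v : ℝ, {z : ℝ | φ z = v}.Countable
  deriv_level_countable : ∀ v : ℝ, {z : ℝ | deriv φ z = v}.Countable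

/-- Genericity of the training inputs. The last condition follows from the others as soon as there
are three inputs. -/
structure GenericInputs {d m : ℕ} (ξ : Fin m → EuclideanSpace ℝ (Fin d)) : Prop where
  injective : Function.Injective ξ
  inner_abs_ne : ∀ i j k, i ≠ j → i ≠ k → j ≠ k →
    |inner ℝ (ξ i) (ξ j)| ≠ |inner ℝ (ξ i) (ξ k)|
  inner_ne_zero : ∀ i j, i ≠ j → |inner ℝ (ξ i) (ξ j)| ≠ 0
  ne_neg : ∀ i j, ξ i ≠ -ξ j

end

/-!
The argument runs through the output weights. If the output weight does not move in step `t`, then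
`∑ j, χ_{t,j} Z^{x_t^L(ξ_j)} = 0` almost surely, so the error signal `χ_t` vanishes as soon as the
last layer features at time `t` are linearly independent (`chi_eq_zero_of_ae_outWeight`). Once all
`χ_t`, `t ≥ T`, vanish, the prediction stands still (`f_succ_of_stall`), hence the loss is
stationary at `f_T(ξ_i)` for every sample that occurs in a later batch.

Linear independence is a statement about all times at once, because it decides which Gaussians are
degenerate. A step without error signal (`χ_t = 0`) changes nothing: features and backpropagated
vectors at time `t + 1` are almost surely those of time `t` (`stallFwd`, `stallBwd`; these have to
follow the mean derivatives as well, which are derivatives of formal expressions). Call a family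
`z s i` *admissible* if it stands still in such steps. `indepX_indepDH` shows, by induction on time,
upwards through the layers for the features and downwards for the backpropagated vectors, that
there are no linear relations except those satisfied by all admissible families.

The induction rests on supports. The support of a centred Gaussian vector is the annihilator of the
functionals of variance zero, so by the induction hypothesis the Gaussians of a layer have all
admissible families in their support (`eq_zero_of_ae_law`). A linear relation between the features
of the layer is a continuous function of the noise, hence holds at every point of the support. In a
layer `l ≥ 2` the forward Gaussians can absorb all other terms of the recursion, so the
preactivations run through all admissible families `H` (`IsProfile.exists_noise`), and
`∑ c φ(a + ε z) = 0` for all `ε` yields `∑ c z = 0` by differentiation at a point with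
`φ'(a) ≠ 0`. The backpropagated vectors are similar. In the first layer only the backpropagated
vectors `D` are free. With `D = 0` the preactivations are `⟪W, ξ_i⟫`; with `D` a small pulse at one
sample `j` before an effective step, their first order variation in the later steps is proportional
to `⟪ξ_j, ξ_i⟫ φ'(⟪W, ξ_j⟫)`. Moving `W` in a direction in which the projections of the inputs have
distinct, nonzero moduli, the condition on combinations of rescaled copies of `φ` gives the
independence (`indepX_one`).

For the supports to be meaningful the covariances must be positive semidefinite and the laws for
different time horizons consistent; both follow from square integrability (`posSemidef_cov`,
`law_map_trunc`).
-/

/-! ### Gaussian measures: full support, support and marginals -/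

open Matrix in
/-- A linear functional of variance zero vanishes on the range of the square root of the
covariance. -/
lemma sum_mul_toEuclideanCLM_sqrt_eq_zero {ι : Type*} [Fintype ι] [DecidableEq ι]
    {S : Matrix ι ι ℝ} (hS : S.PosSemidef) {c : ι → ℝ} (hc : c ⬝ᵥ S *ᵥ c = 0)
    (u : EuclideanSpace ℝ ι) :
    ∑ a, c a * toEuclideanCLM (𝕜 := ℝ) (open scoped MatrixOrder in CFC.sqrt S) u a = 0 := by
  open scoped MatrixOrder in
  set R : Matrix ι ι ℝ := CFC.sqrt S with hR
  have hRR : R * R = S := CFC.sqrt_mul_sqrt_self _ hS.nonneg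
  have hRs : IsSelfAdjoint R := (CFC.sqrt_nonneg S).isSelfAdjoint
  have hRt : Rᵀ = R := by
    have := hRs.star_eq
    rwa [Matrix.star_eq_conjTranspose, Matrix.conjTranspose_eq_transpose_of_trivial] at this
  have h1 : (R *ᵥ c) ⬝ᵥ (R *ᵥ c) = 0 := by
    rw [Matrix.dotProduct_mulVec, ← Matrix.mulVec_transpose, hRt, Matrix.mulVec_mulVec, hRR,
      dotProduct_comm, hc]
  have h2 : R *ᵥ c = 0 := dotProduct_self_eq_zero.mp h1
  have h3 : ∑ a, c a * toEuclideanCLM (𝕜 := ℝ) R u a = c ⬝ᵥ (R *ᵥ (WithLp.ofLp u)) := by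
    simp [dotProduct, ofLp_toEuclideanCLM]
  rw [h3, Matrix.dotProduct_mulVec, ← Matrix.mulVec_transpose, hRt, h2, zero_dotProduct]

open Matrix in
/-- The range of the square root of a positive semidefinite matrix consists of the vectors
annihilated by all functionals of variance zero. -/
lemma exists_toEuclideanCLM_sqrt_eq {ι : Type*} [Fintype ι] [DecidableEq ι]
    {S : Matrix ι ι ℝ} (hS : S.PosSemidef) {z : ι → ℝ}
    (hz : ∀ c : ι → ℝ, c ⬝ᵥ S *ᵥ c = 0 → ∑ a, c a * z a = 0) :
    ∃ u : EuclideanSpace ℝ ι,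
      ∀ a, toEuclideanCLM (𝕜 := ℝ) (open scoped MatrixOrder in CFC.sqrt S) u a = z a := by
  open scoped MatrixOrder in
  set R : Matrix ι ι ℝ := CFC.sqrt S with hR
  have hRR : R * R = S := CFC.sqrt_mul_sqrt_self _ hS.nonneg
  have hRs : IsSelfAdjoint R := (CFC.sqrt_nonneg S).isSelfAdjoint
  set A : EuclideanSpace ℝ ι →L[ℝ] EuclideanSpace ℝ ι := toEuclideanCLM (𝕜 := ℝ) R with hA
  have hAs : ContinuousLinearMap.adjoint A = A := (hRs.map (toEuclideanCLM (𝕜 := ℝ))).star_eq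
  have hmem : (WithLp.toLp 2 z : EuclideanSpace ℝ ι) ∈ A.kerᗮ := by
    rw [Submodule.mem_orthogonal]
    intro c hc
    have hc' : R *ᵥ (WithLp.ofLp c) = 0 := by
      have : A c = 0 := hc
      rw [← ofLp_toEuclideanCLM, ← hA, this]; rfl
    have hcS : (WithLp.ofLp c) ⬝ᵥ S *ᵥ (WithLp.ofLp c) = 0 := by
      rw [← hRR, ← Matrix.mulVec_mulVec, hc', Matrix.mulVec_zero, dotProduct_zero]
    have := hz _ hcS
    simpa [PiLp.inner_apply, mul_comm] using this
  rw [ContinuousLinearMap.orthogonal_ker, hAs,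
    (Submodule.closed_of_finiteDimensional _).submodule_topologicalClosure_eq] at hmem
  obtain ⟨u, hu⟩ := hmem
  refine ⟨u, fun a => ?_⟩
  have hu' : A u = WithLp.toLp 2 z := hu
  rw [hu']

lemma isOpenPosMeasure_gaussianReal_zero_one : (gaussianReal 0 1).IsOpenPosMeasure :=
  (gaussianReal_absolutelyContinuous' 0 one_ne_zero).isOpenPosMeasure

lemma isOpenPosMeasure_stdGaussian (E : Type*) [NormedAddCommGroup E] [InnerProductSpace ℝ E]
    [FiniteDimensional ℝ E] [MeasurableSpace E] [BorelSpace E] :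
    (stdGaussian E).IsOpenPosMeasure := by
  have := isOpenPosMeasure_gaussianReal_zero_one
  rw [stdGaussian]
  refine Continuous.isOpenPosMeasure_map (by fun_prop) fun v =>
    ⟨(stdOrthonormalBasis ℝ E).repr v, ?_⟩
  exact (stdOrthonormalBasis ℝ E).sum_repr v

open Matrix in
/-- Marginals of a centred multivariate Gaussian, along an arbitrary map of index sets. -/
lemma map_reindex_multivariateGaussian {ι κ : Type*} [Fintype ι] [DecidableEq ι] [Fintype κ]
    [DecidableEq κ] {S : Matrix ι ι ℝ} (hS : S.PosSemidef) (f : κ → ι) :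
    (multivariateGaussian 0 S).map (fun x => (WithLp.toLp 2 (fun k => x (f k)) :
      EuclideanSpace ℝ κ)) = multivariateGaussian 0 (S.submatrix f f) := by
  let T : EuclideanSpace ℝ ι →L[ℝ] EuclideanSpace ℝ κ := LinearMap.toContinuousLinearMap
    { toFun := fun x => WithLp.toLp 2 (fun k => x (f k))
      map_add' := fun x y => by ext; simp
      map_smul' := fun x y => by ext; simp }
  change (multivariateGaussian 0 S).map T = _
  apply IsGaussian.ext
  · simp only [id_eq, integral_id_multivariateGaussian]
    rw [ContinuousLinearMap.integral_id_map, integral_id_multivariateGaussian, map_zero]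
    exact IsGaussian.integrable_id
  rw [← ContinuousLinearMap.toBilinForm_inj]
  refine LinearMap.BilinForm.ext_basis (EuclideanSpace.basisFun κ ℝ).toBasis fun i j => ?_
  rw [ContinuousLinearMap.toBilinForm_apply, ContinuousLinearMap.toBilinForm_apply,
    covarianceBilin_apply_eq_cov, covariance_map]
  · have (i : κ) : (fun u => inner ℝ ((EuclideanSpace.basisFun κ ℝ).toBasis i) u) ∘
        T = fun u => u (f i) := by ext; simp [PiLp.inner_apply, T]
    simp_rw [this, covariance_eval_multivariateGaussian hS,
      covarianceBilin_multivariateGaussian (hS.submatrix _)]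
    simp
  any_goals exact Measurable.aestronglyMeasurable (by fun_prop)
  · fun_prop
  · exact IsGaussian.memLp_two_id

/-! ### The law of the noise of a layer -/

section Noise

variable {m d : ℕ}

/-- A covariance function of the families `(z s i)`, `s < p`, as a matrix. -/
def covMatrix {p : ℕ} (K : Fin p → Fin m → Fin p → Fin m → ℝ) :
    Matrix (Fin p × Fin m) (Fin p × Fin m) ℝ :=
  Matrix.of fun a b => K a.1 a.2 b.1 b.2

/-- Extension by zero of a family indexed by the times `< p`. -/
def extendZero {p : ℕ} (z : EuclideanSpace ℝ (Fin p × Fin m)) : ℕ → Fin m → ℝ :=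
  fun s i => if h : s < p then z (⟨s, h⟩, i) else 0

/-- Truncation of a family to the times `< p`. -/
def truncSeq (p : ℕ) (z : ℕ → Fin m → ℝ) : ℕ → Fin m → ℝ :=
  fun s i => if s < p then z s i else 0

lemma continuous_extendZero {p : ℕ} : Continuous (extendZero (m := m) (p := p)) := by
  refine continuous_pi fun s => continuous_pi fun i => ?_
  unfold extendZero
  split_ifs <;> fun_prop

lemma continuous_truncSeq (p : ℕ) : Continuous (truncSeq (m := m) p) := by
  refine continuous_pi fun s => continuous_pi fun i => ?_
  unfold truncSeq
  split_ifs <;> fun_prop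

lemma gaussianFamily_eq {p : ℕ} (K : Fin p → Fin m → Fin p → Fin m → ℝ) :
    gaussianFamily p K = (multivariateGaussian 0 (covMatrix K)).map extendZero := rfl

instance {p : ℕ} (K : Fin p → Fin m → Fin p → Fin m → ℝ) :
    IsProbabilityMeasure (gaussianFamily p K) := by
  rw [gaussianFamily_eq]
  exact Measure.isProbabilityMeasure_map continuous_extendZero.measurable.aemeasurable

instance {p q : ℕ} (Kf : Fin p → Fin m → Fin p → Fin m → ℝ)
    (Kb : Fin q → Fin m → Fin q → Fin m → ℝ) :
    IsProbabilityMeasure (layerLaw (d := d) Kf Kb) := by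
  unfold layerLaw; infer_instance

/-- Gaussian families are projective in the number of times. -/
lemma gaussianFamily_map_truncSeq {p p' : ℕ} (hp : p ≤ p')
    {K : Fin p → Fin m → Fin p → Fin m → ℝ} {K' : Fin p' → Fin m → Fin p' → Fin m → ℝ}
    (hK' : (covMatrix K').PosSemidef)
    (hKK' : ∀ a i b j, K a i b j = K' (Fin.castLE hp a) i (Fin.castLE hp b) j) :
    (gaussianFamily p' K').map (truncSeq p) = gaussianFamily p K := by
  let r : Fin p × Fin m → Fin p' × Fin m := fun a => (Fin.castLE hp a.1, a.2)
  have h1 : covMatrix K = (covMatrix K').submatrix r r := by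
    ext a b; simp [covMatrix, hKK', r]
  rw [gaussianFamily_eq, gaussianFamily_eq, h1, ← map_reindex_multivariateGaussian hK' r,
    Measure.map_map (continuous_truncSeq p).measurable continuous_extendZero.measurable,
    Measure.map_map continuous_extendZero.measurable (by fun_prop)]
  congr 1
  ext z s i
  by_cases hs : s < p
  · have : s < p' := lt_of_lt_of_le hs hp
    simp [truncSeq, extendZero, hs, this, r]
  · simp [truncSeq, extendZero, hs]

namespace Noise

/-- Truncation of the noise to the forward Gaussians of times `< p` and the backward Gaussians of
times `< q`. -/
def trunc (p q : ℕ) (ω : Noise d m) : Noise d m :=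
  (ω.1, ω.2.1, truncSeq p ω.2.2.1, truncSeq q ω.2.2.2)

lemma measurable_trunc (p q : ℕ) : Measurable (trunc (d := d) (m := m) p q) := by
  have h1 := (continuous_truncSeq (m := m) p).measurable
  have h2 := (continuous_truncSeq (m := m) q).measurable
  unfold trunc
  fun_prop

/-- `F` only depends on the forward Gaussians of times `< p`, the backward Gaussians of times `< q`
and the initial weights. -/
def DependsUpTo {β : Type*} (p q : ℕ) (F : Noise d m → β) : Prop :=
  ∀ ω ω' : Noise d m, ω.inW = ω'.inW → ω.outW = ω'.outW → (∀ s, s < p → ω.fwd s = ω'.fwd s) →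
    (∀ s, s < q → ω.bwd s = ω'.bwd s) → F ω = F ω'

lemma DependsUpTo.mono {β : Type*} {p q p' q' : ℕ} {F : Noise d m → β} (hF : DependsUpTo p q F)
    (hp : p ≤ p') (hq : q ≤ q') : DependsUpTo p' q' F :=
  fun ω ω' h1 h2 h3 h4 => hF ω ω' h1 h2 (fun s hs => h3 s (hs.trans_le hp))
    (fun s hs => h4 s (hs.trans_le hq))

lemma DependsUpTo.comp_trunc {β : Type*} {p q : ℕ} {F : Noise d m → β} (hF : DependsUpTo p q F)
    (ω : Noise d m) : F (trunc p q ω) = F ω := by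
  refine hF _ _ rfl rfl (fun s hs => ?_) (fun s hs => ?_)
  · ext i; simp [trunc, fwd, truncSeq, hs]
  · ext i; simp [trunc, bwd, truncSeq, hs]

end Noise

open Noise

lemma layerLaw_map_trunc {p q p' q' : ℕ} (hp : p ≤ p') (hq : q ≤ q')
    {Kf : Fin p → Fin m → Fin p → Fin m → ℝ} {Kb : Fin q → Fin m → Fin q → Fin m → ℝ}
    {Kf' : Fin p' → Fin m → Fin p' → Fin m → ℝ} {Kb' : Fin q' → Fin m → Fin q' → Fin m → ℝ}
    (hKf' : (covMatrix Kf').PosSemidef) (hKb' : (covMatrix Kb').PosSemidef)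
    (hf : ∀ a i b j, Kf a i b j = Kf' (Fin.castLE hp a) i (Fin.castLE hp b) j)
    (hb : ∀ a i b j, Kb a i b j = Kb' (Fin.castLE hq a) i (Fin.castLE hq b) j) :
    (layerLaw (d := d) Kf' Kb').map (trunc p q) = layerLaw Kf Kb := by
  have h1 := (continuous_truncSeq (m := m) p).measurable
  have h2 := (continuous_truncSeq (m := m) q).measurable
  have hT : trunc (d := d) (m := m) p q =
      Prod.map id (Prod.map id (Prod.map (truncSeq p) (truncSeq q))) := rfl
  rw [hT, layerLaw, layerLaw, ← Measure.map_prod_map _ _ measurable_id (by fun_prop),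
    ← Measure.map_prod_map _ _ measurable_id (by fun_prop), ← Measure.map_prod_map _ _ h1 h2,
    Measure.map_id, Measure.map_id, gaussianFamily_map_truncSeq hp hKf' hf,
    gaussianFamily_map_truncSeq hq hKb' hb]

/-- A continuous function that vanishes almost surely vanishes at every point of the support. The
support of the law of a Gaussian family consists of the families annihilated by all linear
functionals of variance zero. -/
lemma eq_zero_of_ae_layerLaw {p q : ℕ} {Kf : Fin p → Fin m → Fin p → Fin m → ℝ}
    {Kb : Fin q → Fin m → Fin q → Fin m → ℝ}
    (hKf : (covMatrix Kf).PosSemidef) (hKb : (covMatrix Kb).PosSemidef) {F : Noise d m → ℝ}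
    (hF : Continuous F) (hdep : DependsUpTo p q F) (h0 : ∀ᵐ ω ∂(layerLaw Kf Kb), F ω = 0)
    (ω : Noise d m)
    (hf : ∀ c : Fin p × Fin m → ℝ, c ⬝ᵥ (covMatrix Kf).mulVec c = 0 →
      ∑ a, c a * ω.fwd a.1 a.2 = 0)
    (hb : ∀ c : Fin q × Fin m → ℝ, c ⬝ᵥ (covMatrix Kb).mulVec c = 0 →
      ∑ a, c a * ω.bwd a.1 a.2 = 0) : F ω = 0 := by
  open scoped MatrixOrder in
  set Rf := Matrix.toEuclideanCLM (𝕜 := ℝ) (CFC.sqrt (covMatrix Kf)) with hRf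
  open scoped MatrixOrder in
  set Rb := Matrix.toEuclideanCLM (𝕜 := ℝ) (CFC.sqrt (covMatrix Kb)) with hRb
  have e1 : gaussianFamily p Kf =
      (stdGaussian (EuclideanSpace ℝ (Fin p × Fin m))).map (fun u => extendZero (Rf u)) := by
    rw [gaussianFamily_eq, multivariateGaussian,
      Measure.map_map continuous_extendZero.measurable (by fun_prop)]
    simp only [zero_add]; rfl
  have e2 : gaussianFamily q Kb =
      (stdGaussian (EuclideanSpace ℝ (Fin q × Fin m))).map (fun u => extendZero (Rb u)) := by
    rw [gaussianFamily_eq, multivariateGaussian,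
      Measure.map_map continuous_extendZero.measurable (by fun_prop)]
    simp only [zero_add]; rfl
  have c1 : Continuous (fun u => extendZero (m := m) (p := p) (Rf u)) :=
    continuous_extendZero.comp Rf.continuous
  have c2 : Continuous (fun u => extendZero (m := m) (p := q) (Rb u)) :=
    continuous_extendZero.comp Rb.continuous
  let Φ : EuclideanSpace ℝ (Fin d) × ℝ × EuclideanSpace ℝ (Fin p × Fin m) ×
      EuclideanSpace ℝ (Fin q × Fin m) → Noise d m :=
    Prod.map id (Prod.map id (Prod.map (fun u => extendZero (Rf u)) (fun u => extendZero (Rb u))))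
  have hΦ : Continuous Φ := by fun_prop
  let P := (stdGaussian (EuclideanSpace ℝ (Fin d))).prod ((gaussianReal 0 1).prod
    ((stdGaussian (EuclideanSpace ℝ (Fin p × Fin m))).prod
      (stdGaussian (EuclideanSpace ℝ (Fin q × Fin m)))))
  have hlaw : layerLaw Kf Kb = P.map Φ := by
    have m1 := c1.measurable
    have m2 := c2.measurable
    simp only [P, Φ]
    rw [layerLaw, ← Measure.map_prod_map _ _ measurable_id (by fun_prop),
      ← Measure.map_prod_map _ _ measurable_id (by fun_prop), ← Measure.map_prod_map _ _ m1 m2,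
      Measure.map_id, Measure.map_id, e1, e2]
  have o1 := isOpenPosMeasure_gaussianReal_zero_one
  have o2 := isOpenPosMeasure_stdGaussian (EuclideanSpace ℝ (Fin d))
  have o3 := isOpenPosMeasure_stdGaussian (EuclideanSpace ℝ (Fin p × Fin m))
  have o4 := isOpenPosMeasure_stdGaussian (EuclideanSpace ℝ (Fin q × Fin m))
  have oP : P.IsOpenPosMeasure := by
    have := Measure.prod.instIsOpenPosMeasure
      (μ := stdGaussian (EuclideanSpace ℝ (Fin p × Fin m)))
      (ν := stdGaussian (EuclideanSpace ℝ (Fin q × Fin m)))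
    have := Measure.prod.instIsOpenPosMeasure (μ := gaussianReal 0 1)
      (ν := (stdGaussian (EuclideanSpace ℝ (Fin p × Fin m))).prod
        (stdGaussian (EuclideanSpace ℝ (Fin q × Fin m))))
    exact Measure.prod.instIsOpenPosMeasure
  rw [hlaw] at h0
  have h1 : ∀ᵐ v ∂P, (F ∘ Φ) v = (fun _ => (0 : ℝ)) v :=
    ae_of_ae_map hΦ.measurable.aemeasurable h0
  have h2 : F ∘ Φ = fun _ => 0 := Measure.eq_of_ae_eq h1 (hF.comp hΦ) continuous_const
  obtain ⟨u, hu⟩ := exists_toEuclideanCLM_sqrt_eq hKf (z := fun a => ω.fwd a.1 a.2) hf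
  obtain ⟨v, hv⟩ := exists_toEuclideanCLM_sqrt_eq hKb (z := fun a => ω.bwd a.1 a.2) hb
  have h3 : F (Φ (ω.inW, ω.outW, u, v)) = 0 := congrFun h2 _
  rw [← h3]
  refine hdep _ _ rfl rfl (fun s hs => ?_) (fun s hs => ?_)
  · ext i
    have := hu (⟨s, hs⟩, i)
    simp [Φ, fwd, extendZero, hs, hRf, this]
  · ext i
    have := hv (⟨s, hs⟩, i)
    simp [Φ, bwd, extendZero, hs, hRb, this]

/-- Linear functionals of variance zero vanish almost surely. -/
lemma ae_gaussianFamily_sum_eq_zero {p : ℕ} {K : Fin p → Fin m → Fin p → Fin m → ℝ}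
    (hK : (covMatrix K).PosSemidef) {c : Fin p × Fin m → ℝ}
    (hc : c ⬝ᵥ (covMatrix K).mulVec c = 0) :
    ∀ᵐ z ∂(gaussianFamily p K), ∑ a, c a * z a.1 a.2 = 0 := by
  rw [gaussianFamily_eq, multivariateGaussian,
    Measure.map_map continuous_extendZero.measurable (by fun_prop)]
  rw [ae_map_iff (Continuous.aemeasurable (continuous_extendZero.comp (by fun_prop)))]
  · refine ae_of_all _ fun u => ?_
    have := sum_mul_toEuclideanCLM_sqrt_eq_zero hK hc u
    simpa [extendZero] using this
  · exact measurableSet_eq_fun (by fun_prop) measurable_const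

section LayerLaw

variable {p q : ℕ} (Kf : Fin p → Fin m → Fin p → Fin m → ℝ)
  (Kb : Fin q → Fin m → Fin q → Fin m → ℝ)

lemma measurePreserving_fwd :
    MeasurePreserving (Noise.fwd (d := d)) (layerLaw Kf Kb) (gaussianFamily p Kf) :=
  measurePreserving_fst.comp (measurePreserving_snd.comp measurePreserving_snd)

lemma measurePreserving_bwd :
    MeasurePreserving (Noise.bwd (d := d)) (layerLaw Kf Kb) (gaussianFamily q Kb) :=
  measurePreserving_snd.comp (measurePreserving_snd.comp measurePreserving_snd)

lemma memLp_two_gaussianFamily (s : ℕ) (i : Fin m) :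
    MemLp (fun z => z s i) 2 (gaussianFamily p Kf) := by
  rw [gaussianFamily_eq, memLp_map_measure_iff (Measurable.aestronglyMeasurable (by fun_prop))
    continuous_extendZero.measurable.aemeasurable]
  by_cases hs : s < p
  · have : ((fun z : ℕ → Fin m → ℝ => z s i) ∘ extendZero (m := m) (p := p)) =
        (fun z => (EuclideanSpace.proj (𝕜 := ℝ) ((⟨s, hs⟩, i) : Fin p × Fin m)) z) := by
      ext z; simp [extendZero, hs]
    rw [this]
    exact IsGaussian.memLp_dual _ _ 2 (by norm_num)
  · have : ((fun z : ℕ → Fin m → ℝ => z s i) ∘ extendZero (m := m) (p := p)) =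
        (fun _ => 0) := by
      ext z; simp [extendZero, hs]
    rw [this]
    exact memLp_const 0

lemma memLp_two_fwd (s : ℕ) (i : Fin m) :
    MemLp (fun ω : Noise d m => ω.fwd s i) 2 (layerLaw Kf Kb) :=
  (memLp_two_gaussianFamily Kf s i).comp_measurePreserving (measurePreserving_fwd Kf Kb)

lemma memLp_two_bwd (s : ℕ) (i : Fin m) :
    MemLp (fun ω : Noise d m => ω.bwd s i) 2 (layerLaw Kf Kb) :=
  (memLp_two_gaussianFamily Kb s i).comp_measurePreserving (measurePreserving_bwd Kf Kb)

lemma memLp_two_outW : MemLp (fun ω : Noise d m => ω.outW) 2 (layerLaw Kf Kb) := by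
  have h : MeasurePreserving (Noise.outW (d := d) (m := m)) (layerLaw Kf Kb) (gaussianReal 0 1) :=
    measurePreserving_fst.comp measurePreserving_snd
  exact (IsGaussian.memLp_two_id (μ := gaussianReal 0 1)).comp_measurePreserving h

lemma memLp_two_inner_inW (v : EuclideanSpace ℝ (Fin d)) :
    MemLp (fun ω : Noise d m => inner ℝ ω.inW v) 2 (layerLaw Kf Kb) := by
  have h : MeasurePreserving (Noise.inW (d := d) (m := m)) (layerLaw Kf Kb) (stdGaussian _) :=
    measurePreserving_fst
  have h1 : MemLp (fun w : EuclideanSpace ℝ (Fin d) => inner ℝ w v) 2 (stdGaussian _) := by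
    simp_rw [real_inner_comm v]
    exact IsGaussian.memLp_dual (stdGaussian (EuclideanSpace ℝ (Fin d))) (innerSL ℝ v) 2
      (by norm_num)
  exact h1.comp_measurePreserving h

end LayerLaw

end Noise

/-! ### Gram matrices -/

open Matrix in
lemma dotProduct_gram_mulVec {Ω ι : Type*} [Fintype ι] [MeasurableSpace Ω] {μ : Measure Ω}
    {X : ι → Ω → ℝ} (hX : ∀ a, MemLp (X a) 2 μ) {S : Matrix ι ι ℝ}
    (hS : ∀ a b, S a b = ∫ ω, X a ω * X b ω ∂μ) (c : ι → ℝ) :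
    c ⬝ᵥ S *ᵥ c = ∫ ω, (∑ a, c a * X a ω) ^ 2 ∂μ := by
  have hint : ∀ a b, Integrable (fun ω => X a ω * X b ω) μ :=
    fun a b => (hX a).integrable_mul (hX b)
  have h1 : ∀ ω, (∑ a, c a * X a ω) ^ 2 = ∑ a, ∑ b, (c a * c b) * (X a ω * X b ω) := fun ω => by
    rw [sq, Finset.sum_mul_sum]
    exact Finset.sum_congr rfl fun a _ => Finset.sum_congr rfl fun b _ => by ring
  simp_rw [h1]
  rw [integral_finsetSum _ fun a _ => integrable_finsetSum _ fun b _ => (hint a b).const_mul _]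
  simp only [dotProduct, mulVec, Finset.mul_sum]
  refine Finset.sum_congr rfl fun a _ => ?_
  rw [integral_finsetSum _ fun b _ => (hint a b).const_mul _]
  refine Finset.sum_congr rfl fun b _ => ?_
  rw [integral_const_mul, hS]
  ring

open Matrix in
lemma posSemidef_gram {Ω ι : Type*} [Fintype ι] [MeasurableSpace Ω] {μ : Measure Ω}
    {X : ι → Ω → ℝ} (hX : ∀ a, MemLp (X a) 2 μ) {S : Matrix ι ι ℝ}
    (hS : ∀ a b, S a b = ∫ ω, X a ω * X b ω ∂μ) : S.PosSemidef := by
  refine PosSemidef.of_dotProduct_mulVec_nonneg ?_ fun c => ?_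
  · ext a b
    simp [hS, mul_comm]
  · rw [star_trivial, dotProduct_gram_mulVec hX hS]
    exact integral_nonneg fun ω => sq_nonneg _

open Matrix in
lemma ae_sum_eq_zero_of_dotProduct_gram {Ω ι : Type*} [Fintype ι] [MeasurableSpace Ω]
    {μ : Measure Ω} {X : ι → Ω → ℝ} (hX : ∀ a, MemLp (X a) 2 μ) {S : Matrix ι ι ℝ}
    (hS : ∀ a b, S a b = ∫ ω, X a ω * X b ω ∂μ) {c : ι → ℝ} (hc : c ⬝ᵥ S *ᵥ c = 0) :
    ∀ᵐ ω ∂μ, ∑ a, c a * X a ω = 0 := by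
  have hm : MemLp (fun ω => ∑ a, c a * X a ω) 2 μ :=
    memLp_finsetSum _ fun a _ => (hX a).const_mul _
  rw [dotProduct_gram_mulVec hX hS,
    integral_eq_zero_iff_of_nonneg (fun ω => sq_nonneg _) hm.integrable_sq] at hc
  filter_upwards [hc] with ω hω
  exact pow_eq_zero_iff two_ne_zero |>.mp hω

namespace MLPTraining

open Noise

variable (M : MLPTraining)

/-! ### The recursion, equation by equation -/

lemma h_of_two_le {l : ℕ} (hl : 2 ≤ l) (t : ℕ) (i : Fin M.m) (ω : Noise M.d M.m) :
    M.h l t i ω = ω.fwd t i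
      + ∑ j : Fin M.m, ∑ s : Fin t, M.dh l s j ω * M.meanPderivX (l - 1) t i s j
      - M.η * ∑ s : Fin t, ∑ j : Fin M.m,
          M.χ s j * M.dh l s j ω * M.gramX (l - 1) s j t i := by
  rw [h, dif_pos hl]

lemma h_of_lt_two {l : ℕ} (hl : ¬ 2 ≤ l) (t : ℕ) (i : Fin M.m) (ω : Noise M.d M.m) :
    M.h l t i ω = inner ℝ ω.inW (M.ξ i)
      - M.η * ∑ s : Fin t, ∑ j : Fin M.m,
          M.χ s j * inner ℝ (M.ξ j) (M.ξ i) * M.dh l s j ω := by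
  rw [h, dif_neg hl]

lemma x_eq (l t : ℕ) (i : Fin M.m) (ω : Noise M.d M.m) : M.x l t i ω = M.φ (M.h l t i ω) := by
  rw [x]

lemma dh_eq (l t : ℕ) (i : Fin M.m) (ω : Noise M.d M.m) :
    M.dh l t i ω = M.dx l t i ω * deriv M.φ (M.h l t i ω) := by
  rw [dh]

lemma outWeight_eq (t : ℕ) (ω : Noise M.d M.m) :
    M.outWeight t ω = ω.outW - M.η * ∑ s : Fin t, ∑ i : Fin M.m, M.χ s i * M.x M.L s i ω := by
  rw [outWeight]

lemma dx_of_lt {l : ℕ} (hl : l < M.L) (t : ℕ) (i : Fin M.m) (ω : Noise M.d M.m) :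
    M.dx l t i ω = ω.bwd t i
      + ∑ j : Fin M.m, ∑ s : Fin (t + 1), M.x l s j ω * M.meanPderivDH (l + 1) t i s j
      - M.η * ∑ s : Fin t, ∑ j : Fin M.m,
          M.χ s j * M.x l s j ω * M.gramDH (l + 1) s j t i := by
  rw [dx, dif_pos hl]

lemma dx_of_not_lt {l : ℕ} (hl : ¬ l < M.L) (t : ℕ) (i : Fin M.m) (ω : Noise M.d M.m) :
    M.dx l t i ω = M.outWeight t ω := by
  rw [dx, dif_neg hl]

lemma gramX_eq (l s : ℕ) (i : Fin M.m) (r : ℕ) (j : Fin M.m) :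
    M.gramX l s i r j = ∫ ω, M.x l s i ω * M.x l r j ω ∂(M.law l (max s r + 1) (max s r)) := by
  rw [gramX]; rfl

lemma meanPderivX_eq (l t : ℕ) (i : Fin M.m) (s : ℕ) (j : Fin M.m) :
    M.meanPderivX l t i s j = ∫ ω, pderivBwd s j (M.x l t i) ω ∂(M.law l (t + 1) t) := by
  rw [meanPderivX]; rfl

lemma gramDH_eq (l s : ℕ) (i : Fin M.m) (r : ℕ) (j : Fin M.m) :
    M.gramDH l s i r j =
      ∫ ω, M.dh l s i ω * M.dh l r j ω ∂(M.law l (max s r + 1) (max s r + 1)) := by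
  rw [gramDH]; rfl

lemma meanPderivDH_eq (l t : ℕ) (i : Fin M.m) (s : ℕ) (j : Fin M.m) :
    M.meanPderivDH l t i s j =
      ∫ ω, pderivFwd s j (M.dh l t i) ω ∂(M.law l (t + 1) (t + 1)) := by
  rw [meanPderivDH]; rfl

lemma f_succ (t : ℕ) (i : Fin M.m) :
    M.f (t + 1) i = M.f t i
      + ∫ ω, ((M.outWeight (t + 1) ω - M.outWeight t ω) * M.x M.L (t + 1) i ω
          + M.outWeight t ω * (M.x M.L (t + 1) i ω - M.x M.L t i ω))
        ∂(M.law M.L (t + 2) (t + 1)) := by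
  rw [f, law]
  simp only [lt_irrefl, if_false, dite_eq_ite]

/-! ### Dependence on the noise, continuity and moments -/

/-- The preactivation at time `t` involves the forward Gaussians up to time `t` and the backward ones
before time `t`; the backpropagated vector at time `t` involves both up to time `t`. -/
lemma dependsUpTo_h_dx (t : ℕ) :
    (∀ l i, DependsUpTo (t + 1) t (M.h l t i)) ∧
      (∀ l i, DependsUpTo (t + 1) (t + 1) (M.dx l t i)) := by
  induction t using Nat.strong_induction_on with
  | _ t ih =>
    have hdh : ∀ s < t, ∀ l j, DependsUpTo (t + 1) t (M.dh l s j) := by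
      intro s hs l j ω ω' h1 h2 h3 h4
      have e1 := ((ih s hs).1 l j).mono (by omega : s + 1 ≤ t + 1) hs.le ω ω' h1 h2 h3 h4
      have e2 := ((ih s hs).2 l j).mono (by omega : s + 1 ≤ t + 1) (by omega) ω ω' h1 h2 h3 h4
      rw [dh_eq, dh_eq, e1, e2]
    have hh : ∀ l i, DependsUpTo (t + 1) t (M.h l t i) := by
      intro l i ω ω' h1 h2 h3 h4
      have e : ∀ (s : Fin t) j, M.dh l s j ω = M.dh l s j ω' :=
        fun s j => hdh s s.2 l j ω ω' h1 h2 h3 h4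
      by_cases hl : 2 ≤ l
      · rw [h_of_two_le M hl, h_of_two_le M hl, h3 t (by omega)]
        simp only [e]
      · rw [h_of_lt_two M hl, h_of_lt_two M hl, h1]
        simp only [e]
    refine ⟨hh, fun l i ω ω' h1 h2 h3 h4 => ?_⟩
    have hx : ∀ s ≤ t, ∀ l j, M.x l s j ω = M.x l s j ω' := by
      intro s hs l j
      rw [x_eq, x_eq]
      rcases hs.eq_or_lt with rfl | hs
      · rw [hh l j ω ω' h1 h2 h3 fun r hr => h4 r (by omega)]
      · rw [(ih s hs).1 l j ω ω' h1 h2 (fun r hr => h3 r (by omega)) fun r hr => h4 r (by omega)]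
    by_cases hl : l < M.L
    · have e : ∀ (s : Fin t) j, M.x l s j ω = M.x l s j ω' := fun s j => hx s s.2.le l j
      have e' : ∀ (s : Fin (t + 1)) j, M.x l s j ω = M.x l s j ω' :=
        fun s j => hx s (Nat.lt_succ_iff.mp s.2) l j
      rw [dx_of_lt M hl, dx_of_lt M hl, h4 t (by omega)]
      simp only [e, e']
    · have e : ∀ (s : Fin t) j, M.x M.L s j ω = M.x M.L s j ω' := fun s j => hx s s.2.le _ j
      rw [dx_of_not_lt M hl, dx_of_not_lt M hl, outWeight_eq, outWeight_eq, h2]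
      simp only [e]

lemma dependsUpTo_x (l t : ℕ) (i : Fin M.m) : DependsUpTo (t + 1) t (M.x l t i) := by
  intro ω ω' h1 h2 h3 h4
  rw [x_eq, x_eq, (M.dependsUpTo_h_dx t).1 l i ω ω' h1 h2 h3 h4]

lemma dependsUpTo_dh (l t : ℕ) (i : Fin M.m) : DependsUpTo (t + 1) (t + 1) (M.dh l t i) := by
  intro ω ω' h1 h2 h3 h4
  rw [dh_eq, dh_eq, (M.dependsUpTo_h_dx t).2 l i ω ω' h1 h2 h3 h4,
    (M.dependsUpTo_h_dx t).1 l i ω ω' h1 h2 h3 fun s hs => h4 s (by omega)]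

lemma dependsUpTo_outWeight (t : ℕ) : DependsUpTo t t (M.outWeight t) := by
  intro ω ω' h1 h2 h3 h4
  have e : ∀ (s : Fin t) j, M.x M.L s j ω = M.x M.L s j ω' := fun s j =>
    (M.dependsUpTo_x M.L s j).mono s.2 s.2.le ω ω' h1 h2 h3 h4
  rw [outWeight_eq, outWeight_eq, h2]
  simp only [e]

variable {M}

lemma continuous_deriv_of_good {φ : ℝ → ℝ} (hφ : GoodActivation φ) : Continuous (deriv φ) :=
  hφ.contDiff.continuous_deriv (by norm_num)

lemma differentiable_of_good {φ : ℝ → ℝ} (hφ : GoodActivation φ) : Differentiable ℝ φ :=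
  hφ.contDiff.differentiable (by norm_num)

lemma differentiable_deriv_of_good {φ : ℝ → ℝ} (hφ : GoodActivation φ) :
    Differentiable ℝ (deriv φ) :=
  ((contDiff_succ_iff_deriv (n := 1)).mp hφ.contDiff).2.2.differentiable (by norm_num)

lemma continuous_deriv_deriv_of_good {φ : ℝ → ℝ} (hφ : GoodActivation φ) :
    Continuous (deriv (deriv φ)) :=
  ((contDiff_succ_iff_deriv (n := 1)).mp hφ.contDiff).2.2.continuous_deriv (by norm_num)

lemma continuous_h_dx (hφ : GoodActivation M.φ) (t : ℕ) :
    (∀ l i, Continuous (M.h l t i)) ∧ (∀ l i, Continuous (M.dx l t i)) := by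
  have hφ0 := hφ.contDiff.continuous
  have hφ1 := continuous_deriv_of_good hφ
  have cfwd : ∀ t i, Continuous fun ω : Noise M.d M.m => ω.fwd t i := fun t i => by
    unfold Noise.fwd; fun_prop
  have cbwd : ∀ t i, Continuous fun ω : Noise M.d M.m => ω.bwd t i := fun t i => by
    unfold Noise.bwd; fun_prop
  have cin : Continuous fun ω : Noise M.d M.m => ω.inW := by unfold Noise.inW; fun_prop
  have cout : Continuous fun ω : Noise M.d M.m => ω.outW := by unfold Noise.outW; fun_prop
  induction t using Nat.strong_induction_on with
  | _ t ih =>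
    have hdh : ∀ (s : Fin t) l j, Continuous (M.dh l s j) := by
      intro s l j
      have e1 := (ih s s.2).1 l j
      have e2 := (ih s s.2).2 l j
      simp_rw [funext (M.dh_eq l s j)]
      fun_prop
    have hh : ∀ l i, Continuous (M.h l t i) := by
      intro l i
      by_cases hl : 2 ≤ l
      · simp_rw [funext (M.h_of_two_le hl t i)]
        fun_prop
      · simp_rw [funext (M.h_of_lt_two hl t i)]
        fun_prop
    refine ⟨hh, fun l i => ?_⟩
    have hx : ∀ s ≤ t, ∀ l j, Continuous (M.x l s j) := by
      intro s hs l j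
      simp_rw [funext (M.x_eq l s j)]
      rcases hs.eq_or_lt with rfl | hs
      · exact hφ0.comp (hh l j)
      · exact hφ0.comp ((ih s hs).1 l j)
    by_cases hl : l < M.L
    · have e : ∀ (s : Fin t) j, Continuous (M.x l s j) := fun s j => hx s s.2.le l j
      have e' : ∀ (s : Fin (t + 1)) j, Continuous (M.x l s j) :=
        fun s j => hx s (Nat.lt_succ_iff.mp s.2) l j
      simp_rw [funext (M.dx_of_lt hl t i)]
      fun_prop
    · have e : ∀ (s : Fin t) j, Continuous (M.x M.L s j) := fun s j => hx s s.2.le _ j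
      simp_rw [funext (M.dx_of_not_lt hl t i), funext (M.outWeight_eq t)]
      fun_prop

lemma continuous_x (hφ : GoodActivation M.φ) (l t : ℕ) (i : Fin M.m) : Continuous (M.x l t i) := by
  simp_rw [funext (M.x_eq l t i)]
  exact hφ.contDiff.continuous.comp ((continuous_h_dx hφ t).1 l i)

lemma continuous_dh (hφ : GoodActivation M.φ) (l t : ℕ) (i : Fin M.m) :
    Continuous (M.dh l t i) := by
  simp_rw [funext (M.dh_eq l t i)]
  exact ((continuous_h_dx hφ t).2 l i).mul
    ((continuous_deriv_of_good hφ).comp ((continuous_h_dx hφ t).1 l i))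

lemma memLp_comp_of_good {φ : ℝ → ℝ} (hφ : GoodActivation φ) {Ω : Type*} [MeasurableSpace Ω]
    {μ : Measure Ω} [IsFiniteMeasure μ] {X : Ω → ℝ} (hX : MemLp X 2 μ) :
    MemLp (fun ω => φ (X ω)) 2 μ := by
  obtain ⟨C, hC⟩ := hφ.deriv_bounded
  have hlip : ∀ z, |φ z - φ 0| ≤ C * |z| := fun z => by
    have := Convex.norm_image_sub_le_of_norm_deriv_le (s := Set.univ) (f := φ) (C := C)
      (fun y _ => (differentiable_of_good hφ) y) (fun y _ => hC y) convex_univ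
      (Set.mem_univ 0) (Set.mem_univ z)
    simpa using this
  have h1 : MemLp (fun ω => φ (X ω) - φ 0) 2 μ :=
    MemLp.of_le_mul (c := C) hX
      ((hφ.contDiff.continuous.comp_aestronglyMeasurable hX.1).sub aestronglyMeasurable_const)
      (ae_of_all _ fun ω => by simpa using hlip (X ω))
  have h2 := h1.add (memLp_const (φ 0))
  refine h2.ae_eq (ae_of_all _ fun ω => ?_)
  simp

lemma memLp_mul_deriv_of_good {φ : ℝ → ℝ} (hφ : GoodActivation φ) {Ω : Type*} [MeasurableSpace Ω]
    {μ : Measure Ω} {X Y : Ω → ℝ} (hX : MemLp X 2 μ) (hY : MemLp Y 2 μ) :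
    MemLp (fun ω => Y ω * deriv φ (X ω)) 2 μ := by
  obtain ⟨C, hC⟩ := hφ.deriv_bounded
  refine MemLp.of_le_mul (c := C) hY
    (hY.1.mul ((continuous_deriv_of_good hφ).comp_aestronglyMeasurable hX.1))
    (ae_of_all _ fun ω => ?_)
  rw [norm_mul, mul_comm]
  exact mul_le_mul_of_nonneg_right (hC _) (norm_nonneg _)

lemma memLp_add_sub_const_mul {Ω : Type*} [MeasurableSpace Ω] {μ : Measure Ω} {X Y Z : Ω → ℝ}
    (c : ℝ) (hX : MemLp X 2 μ) (hY : MemLp Y 2 μ) (hZ : MemLp Z 2 μ) :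
    MemLp (fun ω => X ω + Y ω - c * Z ω) 2 μ :=
  (hX.add hY).sub (hZ.const_mul c)

lemma memLp_sub_const_mul {Ω : Type*} [MeasurableSpace Ω] {μ : Measure Ω} {X Z : Ω → ℝ}
    (c : ℝ) (hX : MemLp X 2 μ) (hZ : MemLp Z 2 μ) : MemLp (fun ω => X ω - c * Z ω) 2 μ :=
  hX.sub (hZ.const_mul c)

section MemLp

variable {p q : ℕ} (Kf : Fin p → Fin M.m → Fin p → Fin M.m → ℝ)
  (Kb : Fin q → Fin M.m → Fin q → Fin M.m → ℝ)

lemma memLp_h_dx (hφ : GoodActivation M.φ) (t : ℕ) :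
    (∀ l i, MemLp (M.h l t i) 2 (layerLaw Kf Kb)) ∧
      (∀ l i, MemLp (M.dx l t i) 2 (layerLaw Kf Kb)) := by
  induction t using Nat.strong_induction_on with
  | _ t ih =>
    have hdh : ∀ (s : Fin t) l j, MemLp (M.dh l s j) 2 (layerLaw Kf Kb) := by
      intro s l j
      rw [funext (M.dh_eq l s j)]
      exact memLp_mul_deriv_of_good hφ ((ih s s.2).1 l j) ((ih s s.2).2 l j)
    have hh : ∀ l i, MemLp (M.h l t i) 2 (layerLaw Kf Kb) := by
      intro l i
      by_cases hl : 2 ≤ l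
      · rw [funext (M.h_of_two_le hl t i)]
        refine memLp_add_sub_const_mul _ (memLp_two_fwd Kf Kb t i) ?_ ?_
        · exact memLp_finsetSum _ fun j _ => memLp_finsetSum _ fun s _ => (hdh s l j).mul_const _
        · exact memLp_finsetSum _ fun s _ => memLp_finsetSum _ fun j _ =>
            ((hdh s l j).const_mul _).mul_const _
      · rw [funext (M.h_of_lt_two hl t i)]
        refine memLp_sub_const_mul _ (memLp_two_inner_inW Kf Kb _) ?_
        exact memLp_finsetSum _ fun s _ => memLp_finsetSum _ fun j _ => (hdh s l j).const_mul _
    refine ⟨hh, fun l i => ?_⟩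
    have hx : ∀ s ≤ t, ∀ l j, MemLp (M.x l s j) 2 (layerLaw Kf Kb) := by
      intro s hs l j
      rw [funext (M.x_eq l s j)]
      rcases hs.eq_or_lt with rfl | hs
      · exact memLp_comp_of_good hφ (hh l j)
      · exact memLp_comp_of_good hφ ((ih s hs).1 l j)
    by_cases hl : l < M.L
    · rw [funext (M.dx_of_lt hl t i)]
      refine memLp_add_sub_const_mul _ (memLp_two_bwd Kf Kb t i) ?_ ?_
      · exact memLp_finsetSum _ fun j _ => memLp_finsetSum _ fun s _ =>
          (hx s (Nat.lt_succ_iff.mp s.2) l j).mul_const _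
      · exact memLp_finsetSum _ fun s _ => memLp_finsetSum _ fun j _ =>
          ((hx s s.2.le l j).const_mul _).mul_const _
    · rw [funext (M.dx_of_not_lt hl t i), funext (M.outWeight_eq t)]
      refine memLp_sub_const_mul _ (memLp_two_outW Kf Kb) ?_
      exact memLp_finsetSum _ fun s _ => memLp_finsetSum _ fun j _ =>
        (hx s s.2.le _ j).const_mul _

lemma memLp_x (hφ : GoodActivation M.φ) (l t : ℕ) (i : Fin M.m) :
    MemLp (M.x l t i) 2 (layerLaw Kf Kb) := by
  rw [funext (M.x_eq l t i)]
  exact memLp_comp_of_good hφ ((memLp_h_dx Kf Kb hφ t).1 l i)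

lemma memLp_dh (hφ : GoodActivation M.φ) (l t : ℕ) (i : Fin M.m) :
    MemLp (M.dh l t i) 2 (layerLaw Kf Kb) := by
  rw [funext (M.dh_eq l t i)]
  exact memLp_mul_deriv_of_good hφ ((memLp_h_dx Kf Kb hφ t).1 l i) ((memLp_h_dx Kf Kb hφ t).2 l i)

end MemLp

/-! ### Consistency of the laws of a layer -/

variable (M) in
/-- Covariance of the forward Gaussians of layer `l`, for the times `< p`. -/
noncomputable def covFwd (l p : ℕ) : Fin p → Fin M.m → Fin p → Fin M.m → ℝ :=
  fun a i b j => if 2 ≤ l then M.gramX (l - 1) a i b j else 0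

variable (M) in
/-- Covariance of the backward Gaussians of layer `l`, for the times `< q`. -/
noncomputable def covBwd (l q : ℕ) : Fin q → Fin M.m → Fin q → Fin M.m → ℝ :=
  fun a i b j => if l < M.L then M.gramDH (l + 1) a i b j else 0

lemma law_eq (l p q : ℕ) : M.law l p q = layerLaw (M.covFwd l p) (M.covBwd l q) := rfl

instance (l p q : ℕ) : IsProbabilityMeasure (M.law l p q) := by
  rw [law_eq]; infer_instance

lemma law_map_trunc_of_posSemidef {l p q p' q' : ℕ} (hp : p ≤ p') (hq : q ≤ q')
    (hf : (covMatrix (M.covFwd l p')).PosSemidef) (hb : (covMatrix (M.covBwd l q')).PosSemidef) :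
    (M.law l p' q').map (trunc p q) = M.law l p q :=
  layerLaw_map_trunc hp hq hf hb (fun _ _ _ _ => rfl) (fun _ _ _ _ => rfl)

lemma integral_law_of_posSemidef {l p q p' q' : ℕ} (hp : p ≤ p') (hq : q ≤ q')
    (hf : (covMatrix (M.covFwd l p')).PosSemidef) (hb : (covMatrix (M.covBwd l q')).PosSemidef)
    {F : Noise M.d M.m → ℝ} (hF : Measurable F) (hdep : DependsUpTo p q F) :
    ∫ ω, F ω ∂(M.law l p q) = ∫ ω, F ω ∂(M.law l p' q') := by
  rw [← law_map_trunc_of_posSemidef hp hq hf hb,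
    integral_map (measurable_trunc p q).aemeasurable hF.aestronglyMeasurable]
  simp only [hdep.comp_trunc]

lemma covFwd_eq_integral {l n : ℕ} (hφ : GoodActivation M.φ) (hl : 2 ≤ l)
    (hf : (covMatrix (M.covFwd (l - 1) (n + 1))).PosSemidef)
    (hb : (covMatrix (M.covBwd (l - 1) n)).PosSemidef) (a b : Fin (n + 1) × Fin M.m) :
    covMatrix (M.covFwd l (n + 1)) a b =
      ∫ ω, M.x (l - 1) a.1 a.2 ω * M.x (l - 1) b.1 b.2 ω ∂(M.law (l - 1) (n + 1) n) := by
  have ha := a.1.2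
  have hb' := b.1.2
  simp only [covMatrix, covFwd, Matrix.of_apply, if_pos hl, gramX_eq]
  refine integral_law_of_posSemidef (by omega) (by omega) hf hb
    ((continuous_x hφ _ _ _).mul (continuous_x hφ _ _ _)).measurable ?_
  intro ω ω' h1 h2 h3 h4
  dsimp only
  rw [(M.dependsUpTo_x _ _ _).mono (by omega) (by omega) ω ω' h1 h2 h3 h4,
    (M.dependsUpTo_x _ b.1 _).mono (by omega) (by omega) ω ω' h1 h2 h3 h4]

lemma covBwd_eq_integral {l n : ℕ} (hφ : GoodActivation M.φ) (hl : l < M.L)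
    (hf : (covMatrix (M.covFwd (l + 1) (n + 1))).PosSemidef)
    (hb : (covMatrix (M.covBwd (l + 1) (n + 1))).PosSemidef) (a b : Fin (n + 1) × Fin M.m) :
    covMatrix (M.covBwd l (n + 1)) a b =
      ∫ ω, M.dh (l + 1) a.1 a.2 ω * M.dh (l + 1) b.1 b.2 ω ∂(M.law (l + 1) (n + 1) (n + 1)) := by
  have ha := a.1.2
  have hb' := b.1.2
  simp only [covMatrix, covBwd, Matrix.of_apply, if_pos hl, gramDH_eq]
  refine integral_law_of_posSemidef (by omega) (by omega) hf hb
    ((continuous_dh hφ _ _ _).mul (continuous_dh hφ _ _ _)).measurable ?_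
  intro ω ω' h1 h2 h3 h4
  dsimp only
  rw [(M.dependsUpTo_dh _ _ _).mono (by omega) (by omega) ω ω' h1 h2 h3 h4,
    (M.dependsUpTo_dh _ b.1 _).mono (by omega) (by omega) ω ω' h1 h2 h3 h4]

/-- The Gram matrices are positive semidefinite, so that the Gaussian families are not degenerate
by convention. The recursion is that of the model: forward through the layers, then backward. -/
lemma posSemidef_cov (hφ : GoodActivation M.φ) (n : ℕ) :
    (∀ l, (covMatrix (M.covFwd l n)).PosSemidef) ∧
      (∀ l, (covMatrix (M.covBwd l n)).PosSemidef) := by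
  induction n with
  | zero =>
    have : ∀ S : Matrix (Fin 0 × Fin M.m) (Fin 0 × Fin M.m) ℝ, S.PosSemidef := fun S => by
      rw [Subsingleton.elim S 0]; exact Matrix.PosSemidef.zero
    exact ⟨fun l => this _, fun l => this _⟩
  | succ n ih =>
    have hF : ∀ l, (covMatrix (M.covFwd l (n + 1))).PosSemidef := by
      intro l
      induction l with
      | zero =>
        have : covMatrix (M.covFwd 0 (n + 1)) = 0 := by ext a b; simp [covMatrix, covFwd]
        rw [this]; exact Matrix.PosSemidef.zero
      | succ l ihl =>
        by_cases hl : 2 ≤ l + 1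
        · exact posSemidef_gram (fun a => memLp_x _ _ hφ _ _ _)
            (covFwd_eq_integral hφ hl ihl (ih.2 l))
        · have : covMatrix (M.covFwd (l + 1) (n + 1)) = 0 := by
            ext a b; simp only [covMatrix, covFwd, if_neg hl]; rfl
          rw [this]; exact Matrix.PosSemidef.zero
    refine ⟨hF, fun l => ?_⟩
    induction hk : M.L - l generalizing l with
    | zero =>
      have hl : ¬ l < M.L := by omega
      have : covMatrix (M.covBwd l (n + 1)) = 0 := by
        ext a b; simp only [covMatrix, covBwd, if_neg hl]; rfl
      rw [this]; exact Matrix.PosSemidef.zero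
    | succ k ihk =>
      have hl : l < M.L := by omega
      exact posSemidef_gram (fun a => memLp_dh _ _ hφ _ _ _)
        (covBwd_eq_integral hφ hl (hF _) (ihk (l + 1) (by omega)))

lemma law_map_trunc (hφ : GoodActivation M.φ) {l p q p' q' : ℕ} (hp : p ≤ p') (hq : q ≤ q') :
    (M.law l p' q').map (trunc p q) = M.law l p q :=
  law_map_trunc_of_posSemidef hp hq ((posSemidef_cov hφ _).1 l) ((posSemidef_cov hφ _).2 l)

lemma integral_law (hφ : GoodActivation M.φ) {l p q p' q' : ℕ} (hp : p ≤ p') (hq : q ≤ q')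
    {F : Noise M.d M.m → ℝ} (hF : Measurable F) (hdep : DependsUpTo p q F) :
    ∫ ω, F ω ∂(M.law l p q) = ∫ ω, F ω ∂(M.law l p' q') :=
  integral_law_of_posSemidef hp hq ((posSemidef_cov hφ _).1 l) ((posSemidef_cov hφ _).2 l) hF hdep

lemma ae_law_mono (hφ : GoodActivation M.φ) {l p q p' q' : ℕ} (hp : p ≤ p') (hq : q ≤ q')
    {F G : Noise M.d M.m → ℝ} (hF : DependsUpTo p q F) (hG : DependsUpTo p q G)
    (h : ∀ᵐ ω ∂(M.law l p q), F ω = G ω) : ∀ᵐ ω ∂(M.law l p' q'), F ω = G ω := by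
  rw [← law_map_trunc hφ hp hq] at h
  have := ae_of_ae_map (measurable_trunc p q).aemeasurable h
  filter_upwards [this] with ω hω
  rwa [hF.comp_trunc, hG.comp_trunc] at hω

lemma ae_law_of_ae_law (hφ : GoodActivation M.φ) {l p q p' q' : ℕ} (hp : p ≤ p') (hq : q ≤ q')
    {F G : Noise M.d M.m → ℝ} (hFc : Continuous F) (hGc : Continuous G)
    (hF : DependsUpTo p q F) (hG : DependsUpTo p q G)
    (h : ∀ᵐ ω ∂(M.law l p' q'), F ω = G ω) : ∀ᵐ ω ∂(M.law l p q), F ω = G ω := by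
  rw [← law_map_trunc hφ hp hq, ae_map_iff (measurable_trunc p q).aemeasurable
    (measurableSet_eq_fun hFc.measurable hGc.measurable)]
  filter_upwards [h] with ω hω
  rwa [hF.comp_trunc, hG.comp_trunc]

end MLPTraining

/-! ### Partial derivatives with respect to the noise -/

namespace Noise

variable {d m : ℕ}

/-- The noise `ω` with the forward Gaussian `fwd s j` replaced by `c`. -/
def updFwd (s : ℕ) (j : Fin m) (c : ℝ) (ω : Noise d m) : Noise d m :=
  (ω.1, ω.2.1, Function.update ω.fwd s (Function.update (ω.fwd s) j c), ω.2.2.2)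

/-- The noise `ω` with the backward Gaussian `bwd s j` replaced by `c`. -/
def updBwd (s : ℕ) (j : Fin m) (c : ℝ) (ω : Noise d m) : Noise d m :=
  (ω.1, ω.2.1, ω.2.2.1, Function.update ω.bwd s (Function.update (ω.bwd s) j c))

lemma pderivFwd_eq (s : ℕ) (j : Fin m) (F : Noise d m → ℝ) (ω : Noise d m) :
    pderivFwd s j F ω = deriv (fun c => F (updFwd s j c ω)) (ω.fwd s j) := rfl

lemma pderivBwd_eq (s : ℕ) (j : Fin m) (F : Noise d m → ℝ) (ω : Noise d m) :
    pderivBwd s j F ω = deriv (fun c => F (updBwd s j c ω)) (ω.bwd s j) := rfl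

lemma fwd_updFwd (s : ℕ) (j : Fin m) (c : ℝ) (ω : Noise d m) (r : ℕ) :
    (updFwd s j c ω).fwd r = if r = s then Function.update (ω.fwd s) j c else ω.fwd r := by
  change Function.update ω.fwd s (Function.update (ω.fwd s) j c) r = _
  rw [Function.update_apply]

lemma bwd_updBwd (s : ℕ) (j : Fin m) (c : ℝ) (ω : Noise d m) (r : ℕ) :
    (updBwd s j c ω).bwd r = if r = s then Function.update (ω.bwd s) j c else ω.bwd r := by
  change Function.update ω.bwd s (Function.update (ω.bwd s) j c) r = _
  rw [Function.update_apply]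

lemma bwd_updFwd (s : ℕ) (j : Fin m) (c : ℝ) (ω : Noise d m) : (updFwd s j c ω).bwd = ω.bwd := rfl

lemma fwd_updBwd (s : ℕ) (j : Fin m) (c : ℝ) (ω : Noise d m) : (updBwd s j c ω).fwd = ω.fwd := rfl

lemma DependsUpTo.pderivFwd {p q s : ℕ} {j : Fin m} {F : Noise d m → ℝ}
    (hF : DependsUpTo p q F) (hs : s < p) : DependsUpTo p q (pderivFwd s j F) := by
  intro ω ω' h1 h2 h3 h4
  rw [pderivFwd_eq, pderivFwd_eq, h3 s hs]
  congr 1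
  ext c
  refine hF _ _ h1 h2 (fun r hr => ?_) h4
  rw [fwd_updFwd, fwd_updFwd, h3 s hs, h3 r hr]

lemma DependsUpTo.pderivBwd {p q s : ℕ} {j : Fin m} {F : Noise d m → ℝ}
    (hF : DependsUpTo p q F) (hs : s < q) : DependsUpTo p q (pderivBwd s j F) := by
  intro ω ω' h1 h2 h3 h4
  rw [pderivBwd_eq, pderivBwd_eq, h4 s hs]
  congr 1
  ext c
  refine hF _ _ h1 h2 h3 (fun r hr => ?_)
  rw [bwd_updBwd, bwd_updBwd, h4 s hs, h4 r hr]

lemma continuous_update_update (s : ℕ) (j : Fin m) :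
    Continuous fun p : (ℕ → Fin m → ℝ) × ℝ =>
      Function.update p.1 s (Function.update (p.1 s) j p.2) := by
  refine continuous_fst.update s ?_
  exact Continuous.update (by fun_prop) j continuous_snd

lemma measurable_pderivFwd (s : ℕ) (j : Fin m) {F : Noise d m → ℝ} (hF : Continuous F) :
    Measurable (pderivFwd s j F) := by
  have hc := continuous_update_update (m := m) s j
  have h1 : Continuous (Function.uncurry fun (ω : Noise d m) (c : ℝ) => F (updFwd s j c ω)) := by
    refine hF.comp ?_
    have := hc.comp (f := fun p : Noise d m × ℝ => (p.1.2.2.1, p.2)) (by fun_prop)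
    unfold Noise.updFwd
    exact (by fun_prop : Continuous fun p : Noise d m × ℝ => p.1.1).prodMk
      ((by fun_prop : Continuous fun p : Noise d m × ℝ => p.1.2.1).prodMk
        (this.prodMk (by fun_prop)))
  have h2 : Measurable fun ω : Noise d m => (ω, ω.fwd s j) := by
    unfold Noise.fwd; fun_prop
  exact (measurable_deriv_with_param h1).comp h2

lemma measurable_pderivBwd (s : ℕ) (j : Fin m) {F : Noise d m → ℝ} (hF : Continuous F) :
    Measurable (pderivBwd s j F) := by
  have hc := continuous_update_update (m := m) s j
  have h1 : Continuous (Function.uncurry fun (ω : Noise d m) (c : ℝ) => F (updBwd s j c ω)) := by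
    refine hF.comp ?_
    have := hc.comp (f := fun p : Noise d m × ℝ => (p.1.2.2.2, p.2)) (by fun_prop)
    unfold Noise.updBwd
    exact (by fun_prop : Continuous fun p : Noise d m × ℝ => p.1.1).prodMk
      ((by fun_prop : Continuous fun p : Noise d m × ℝ => p.1.2.1).prodMk
        ((by fun_prop : Continuous fun p : Noise d m × ℝ => p.1.2.2.1).prodMk this))
  have h2 : Measurable fun ω : Noise d m => (ω, ω.bwd s j) := by
    unfold Noise.bwd; fun_prop
  exact (measurable_deriv_with_param h1).comp h2

end Noise

/-- Two entries of a Gaussian family at distance zero agree almost surely. -/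
lemma ae_gaussianFamily_eq {m p : ℕ} {K : Fin p → Fin m → Fin p → Fin m → ℝ}
    (hK : (covMatrix K).PosSemidef) (a b : Fin p × Fin m)
    (h : covMatrix K a a - covMatrix K a b - covMatrix K b a + covMatrix K b b = 0) :
    ∀ᵐ z ∂(gaussianFamily p K), z a.1 a.2 = z b.1 b.2 := by
  have hc : (Pi.single a 1 - Pi.single b 1 : Fin p × Fin m → ℝ) ⬝ᵥ
      (covMatrix K).mulVec (Pi.single a 1 - Pi.single b 1) = 0 := by
    rw [Matrix.mulVec_sub, sub_dotProduct, dotProduct_sub, dotProduct_sub]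
    simp only [Matrix.mulVec_single_one, single_one_dotProduct, Matrix.col_apply]
    linarith
  filter_upwards [ae_gaussianFamily_sum_eq_zero hK hc] with z hz
  have e : ∑ c, (Pi.single a 1 - Pi.single b 1 : Fin p × Fin m → ℝ) c * z c.1 c.2 =
      z a.1 a.2 - z b.1 b.2 := by
    simp [sub_mul, Finset.sum_sub_distrib, Pi.single_apply]
  rw [e] at hz
  linarith

lemma hasDerivAt_comp_add_sub {f : ℝ → ℝ} {f' a : ℝ} (hf : HasDerivAt f f' a) (b : ℝ) :
    HasDerivAt (fun c => f (a + (c - b))) f' b := by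
  have h1 : HasDerivAt (fun c => a + (c - b)) 1 b := ((hasDerivAt_id b).sub_const b).const_add a
  have h2 : HasDerivAt f f' (a + (b - b)) := by rwa [sub_self, add_zero]
  have h3 := HasDerivAt.comp b h2 h1
  rw [mul_one] at h3
  exact h3

namespace MLPTraining

open Noise

/-! ### Steps without an error signal -/

/-- The forward coefficients of layer `l` at time `t + 1`, when no weight moves in step `t`: they
are those of time `t`, and there is no dependence on the new backward Gaussians. -/
structure StallFwd (M : MLPTraining) (t l : ℕ) : Prop where
  gram_le : ∀ s ≤ t, ∀ j i, M.gramX l s j (t + 1) i = M.gramX l s j t i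
  gram_self : ∀ i j, M.gramX l (t + 1) i (t + 1) j = M.gramX l t i t j
  pderiv_lt : ∀ s < t, ∀ i j, M.meanPderivX l (t + 1) i s j = M.meanPderivX l t i s j
  pderiv_self : ∀ i j, M.meanPderivX l (t + 1) i t j = 0

/-- The backward coefficients of layer `l` at time `t + 1`, when no weight moves in step `t`. As the
forward Gaussians of times `t` and `t + 1` agree almost surely, only the sum of the two mean
derivatives with respect to them is determined by time `t`. -/
structure StallBwd (M : MLPTraining) (t l : ℕ) : Prop where
  gram_le : ∀ s ≤ t, ∀ j i, M.gramDH l s j (t + 1) i = M.gramDH l s j t i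
  gram_self : ∀ i j, M.gramDH l (t + 1) i (t + 1) j = M.gramDH l t i t j
  pderiv_lt : ∀ s < t, ∀ i j, M.meanPderivDH l (t + 1) i s j = M.meanPderivDH l t i s j
  pderiv_add : ∀ i j, M.meanPderivDH l (t + 1) i t j + M.meanPderivDH l (t + 1) i (t + 1) j =
    M.meanPderivDH l t i t j

variable {M : MLPTraining}

lemma h_succ_of_stall {t l : ℕ} (hχ : ∀ j, M.χ t j = 0) (hl : 2 ≤ l → M.StallFwd t (l - 1))
    (i : Fin M.m) (ω : Noise M.d M.m) :
    M.h l (t + 1) i ω = M.h l t i ω + if 2 ≤ l then ω.fwd (t + 1) i - ω.fwd t i else 0 := by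
  by_cases h2 : 2 ≤ l
  · have hs := hl h2
    rw [h_of_two_le M h2, h_of_two_le M h2, if_pos h2]
    simp only [Fin.sum_univ_castSucc, Fin.val_castSucc, Fin.val_last, hs.pderiv_self, hχ, mul_zero,
      zero_mul, add_zero, Finset.sum_const_zero]
    have e1 : ∀ (s : Fin t) j, M.meanPderivX (l - 1) (t + 1) i s j =
        M.meanPderivX (l - 1) t i s j := fun s j => hs.pderiv_lt s s.2 i j
    have e2 : ∀ (s : Fin t) j, M.gramX (l - 1) s j (t + 1) i = M.gramX (l - 1) s j t i :=
      fun s j => hs.gram_le s s.2.le j i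
    simp only [e1, e2]
    ring
  · rw [h_of_lt_two M h2, h_of_lt_two M h2, if_neg h2]
    simp only [Fin.sum_univ_castSucc, Fin.val_castSucc, Fin.val_last, hχ,
      zero_mul, add_zero, Finset.sum_const_zero]

lemma gramX_symm (l s : ℕ) (i : Fin M.m) (r : ℕ) (j : Fin M.m) :
    M.gramX l s i r j = M.gramX l r j s i := by
  rw [gramX_eq, gramX_eq, max_comm]; simp only [mul_comm]

lemma gramDH_symm (l s : ℕ) (i : Fin M.m) (r : ℕ) (j : Fin M.m) :
    M.gramDH l s i r j = M.gramDH l r j s i := by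
  rw [gramDH_eq, gramDH_eq, max_comm]; simp only [mul_comm]

lemma ae_fwd_succ_of_stall (hφ : GoodActivation M.φ) {t l p q : ℕ} (h2 : 2 ≤ l)
    (hs : M.StallFwd t (l - 1)) (hp : t + 2 ≤ p) :
    ∀ᵐ ω ∂(M.law l p q), ω.fwd (t + 1) = ω.fwd t := by
  have h : ∀ i, ∀ᵐ ω ∂(M.law l p q), ω.fwd (t + 1) i = ω.fwd t i := by
    intro i
    have := ae_gaussianFamily_eq ((posSemidef_cov hφ p).1 l) (⟨t + 1, by omega⟩, i)
      (⟨t, by omega⟩, i) (by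
        simp only [covMatrix, covFwd, Matrix.of_apply, if_pos h2]
        rw [gramX_symm _ (t + 1) _ t, hs.gram_self, hs.gram_le t le_rfl]
        ring)
    exact (measurePreserving_fwd (d := M.d) _ (M.covBwd l q)).quasiMeasurePreserving.ae this
  filter_upwards [ae_all_iff.mpr h] with ω hω
  exact funext hω

lemma ae_bwd_succ_of_stall (hφ : GoodActivation M.φ) {t l p q : ℕ} (h2 : l < M.L)
    (hs : M.StallBwd t (l + 1)) (hq : t + 2 ≤ q) :
    ∀ᵐ ω ∂(M.law l p q), ω.bwd (t + 1) = ω.bwd t := by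
  have h : ∀ i, ∀ᵐ ω ∂(M.law l p q), ω.bwd (t + 1) i = ω.bwd t i := by
    intro i
    have := ae_gaussianFamily_eq ((posSemidef_cov hφ q).2 l) (⟨t + 1, by omega⟩, i)
      (⟨t, by omega⟩, i) (by
        simp only [covMatrix, covBwd, Matrix.of_apply, if_pos h2]
        rw [gramDH_symm _ (t + 1) _ t, hs.gram_self, hs.gram_le t le_rfl]
        ring)
    exact (measurePreserving_bwd (d := M.d) (M.covFwd l p) _).quasiMeasurePreserving.ae this
  filter_upwards [ae_all_iff.mpr h] with ω hω
  exact funext hω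

lemma stallFwd_of_stallFwd_pred (hφ : GoodActivation M.φ) {t l : ℕ} (hχ : ∀ j, M.χ t j = 0)
    (hl : 2 ≤ l → M.StallFwd t (l - 1)) : M.StallFwd t l := by
  have hx : ∀ ω : Noise M.d M.m, (2 ≤ l → ω.fwd (t + 1) = ω.fwd t) →
      ∀ i, M.x l (t + 1) i ω = M.x l t i ω := by
    intro ω hω i
    rw [x_eq, x_eq, h_succ_of_stall hχ hl]
    split_ifs with h2
    · rw [hω h2]; simp
    · simp
  have hae : ∀ q, ∀ᵐ ω ∂(M.law l (t + 2) q), 2 ≤ l → ω.fwd (t + 1) = ω.fwd t := by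
    intro q
    by_cases h2 : 2 ≤ l
    · filter_upwards [ae_fwd_succ_of_stall hφ (q := q) h2 (hl h2) le_rfl] with ω hω _ using hω
    · exact ae_of_all _ fun ω h => absurd h h2
  have hdep : ∀ s ≤ t, ∀ r ≤ t, ∀ i j,
      DependsUpTo (max s r + 1) (max s r) fun ω => M.x l s i ω * M.x l r j ω := by
    intro s hs r hr i j ω ω' h1 h2 h3 h4
    dsimp only
    rw [(M.dependsUpTo_x l s i).mono (by omega) (by omega) ω ω' h1 h2 h3 h4,
      (M.dependsUpTo_x l r j).mono (by omega) (by omega) ω ω' h1 h2 h3 h4]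
  have hm : ∀ s r i j, Measurable fun ω => M.x l s i ω * M.x l r j ω := fun s r i j =>
    ((continuous_x hφ _ _ _).mul (continuous_x hφ _ _ _)).measurable
  refine ⟨fun s hs j i => ?_, fun i j => ?_, fun s hs i j => ?_, fun i j => ?_⟩
  · rw [gramX_eq, gramX_eq, max_eq_right (by omega : s ≤ t + 1),
      integral_law hφ (p' := t + 1 + 1) (q' := t + 1) (by omega) (by omega) (hm _ _ _ _)
        (hdep s hs t le_rfl j i)]
    refine integral_congr_ae ?_
    filter_upwards [hae (t + 1)] with ω hω
    rw [hx ω hω]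
  · rw [gramX_eq, gramX_eq, max_self,
      integral_law hφ (p' := t + 1 + 1) (q' := t + 1) (by omega) (by omega) (hm _ _ _ _)
        (hdep t le_rfl t le_rfl i j)]
    refine integral_congr_ae ?_
    filter_upwards [hae (t + 1)] with ω hω
    rw [hx ω hω, hx ω hω]
  · rw [meanPderivX_eq, meanPderivX_eq,
      integral_law hφ (p' := t + 1 + 1) (q' := t + 1) (by omega) (by omega)
        (measurable_pderivBwd s j (continuous_x hφ l t i))
        ((M.dependsUpTo_x l t i).pderivBwd hs)]
    refine integral_congr_ae ?_
    filter_upwards [hae (t + 1)] with ω hω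
    rw [pderivBwd_eq, pderivBwd_eq]
    congr 1
    ext c
    exact hx _ (by simpa only [fwd_updBwd] using hω) i
  · rw [meanPderivX_eq]
    refine integral_eq_zero_of_ae ?_
    filter_upwards [hae (t + 1)] with ω hω
    rw [pderivBwd_eq]
    -- The variables of time `t` do not involve the backward Gaussians of time `t`.
    have : (fun c => M.x l (t + 1) i (updBwd t j c ω)) = fun _ => M.x l t i ω := by
      ext c
      rw [hx _ (by simpa only [fwd_updBwd] using hω) i]
      refine M.dependsUpTo_x l t i _ _ rfl rfl (fun _ _ => rfl) fun s hs => ?_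
      rw [bwd_updBwd, if_neg (by omega)]
    rw [this, deriv_const]
    rfl

lemma stallFwd (hφ : GoodActivation M.φ) {t : ℕ} (hχ : ∀ j, M.χ t j = 0) (l : ℕ) :
    M.StallFwd t l := by
  induction l with
  | zero => exact stallFwd_of_stallFwd_pred hφ hχ (by omega)
  | succ l ih => exact stallFwd_of_stallFwd_pred hφ hχ fun _ => by simpa using ih

variable (M) in
/-- Weight of the newest forward feature `x_t^l(ξ_j)` in `dx_t^l(ξ_i)`. -/
noncomputable def newestCoeff (l t : ℕ) (i j : Fin M.m) : ℝ :=
  if l < M.L then M.meanPderivDH (l + 1) t i t j else 0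

lemma dx_succ_of_stall {t l : ℕ} (hχ : ∀ j, M.χ t j = 0) (hl : l < M.L → M.StallBwd t (l + 1))
    (i : Fin M.m) (ω : Noise M.d M.m) :
    M.dx l (t + 1) i ω = M.dx l t i ω + (if l < M.L then ω.bwd (t + 1) i - ω.bwd t i else 0)
      + ∑ j, (M.x l (t + 1) j ω - M.x l t j ω) * M.newestCoeff l (t + 1) i j := by
  by_cases h2 : l < M.L
  · have hs := hl h2
    rw [dx_of_lt M h2, dx_of_lt M h2, if_pos h2]
    simp only [newestCoeff, if_pos h2]
    simp only [Fin.sum_univ_castSucc, Fin.val_castSucc, Fin.val_last, hχ,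
      zero_mul, add_zero, Finset.sum_const_zero, ← hs.pderiv_add]
    have e1 : ∀ (s : Fin t) j, M.meanPderivDH (l + 1) (t + 1) i s j =
        M.meanPderivDH (l + 1) t i s j := fun s j => hs.pderiv_lt s s.2 i j
    have e2 : ∀ (s : Fin t) j, M.gramDH (l + 1) s j (t + 1) i = M.gramDH (l + 1) s j t i :=
      fun s j => hs.gram_le s s.2.le j i
    simp only [e1, e2, Finset.sum_add_distrib, mul_add, sub_mul, Finset.sum_sub_distrib]
    ring
  · rw [dx_of_not_lt M h2, dx_of_not_lt M h2, if_neg h2, outWeight_eq, outWeight_eq]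
    simp only [newestCoeff, if_neg h2]
    simp only [Fin.sum_univ_castSucc, Fin.val_castSucc, Fin.val_last, hχ,
      zero_mul, mul_zero, add_zero, Finset.sum_const_zero]

lemma h_updFwd {t l : ℕ} (h2 : 2 ≤ l) (i j : Fin M.m) (c : ℝ) (ω : Noise M.d M.m) :
    M.h l t i (updFwd t j c ω) = M.h l t i ω + if i = j then c - ω.fwd t j else 0 := by
  have e : ∀ (s : Fin t) k, M.dh l s k (updFwd t j c ω) = M.dh l s k ω := fun s k => by
    refine M.dependsUpTo_dh l s k _ _ rfl rfl (fun r hr => ?_) fun r _ => rfl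
    have := s.2
    rw [fwd_updFwd, if_neg (by omega)]
  rw [h_of_two_le M h2, h_of_two_le M h2]
  simp only [e, fwd_updFwd, if_true]
  by_cases hij : i = j
  · subst hij; simp; ring
  · simp [hij]

lemma dx_updFwd {t l : ℕ} (h2 : 2 ≤ l) (i j : Fin M.m) (c : ℝ) (ω : Noise M.d M.m) :
    M.dx l t i (updFwd t j c ω) = M.dx l t i ω +
      (M.φ (M.h l t j ω + (c - ω.fwd t j)) - M.φ (M.h l t j ω)) * M.newestCoeff l t i j := by
  have e : ∀ (l : ℕ) (s : Fin t) k, M.x l s k (updFwd t j c ω) = M.x l s k ω := fun l s k => by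
    refine M.dependsUpTo_x l s k _ _ rfl rfl (fun r hr => ?_) fun r _ => rfl
    have := s.2
    rw [fwd_updFwd, if_neg (by omega)]
  by_cases hl : l < M.L
  · rw [dx_of_lt M hl, dx_of_lt M hl]
    simp only [newestCoeff, if_pos hl, Fin.sum_univ_castSucc, Fin.val_castSucc, Fin.val_last, e,
      bwd_updFwd, Finset.sum_add_distrib]
    have e1 : ∑ k, M.x l t k (updFwd t j c ω) * M.meanPderivDH (l + 1) t i t k =
        ∑ k, M.x l t k ω * M.meanPderivDH (l + 1) t i t k +
        (M.φ (M.h l t j ω + (c - ω.fwd t j)) - M.φ (M.h l t j ω)) *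
          M.meanPderivDH (l + 1) t i t j := by
      rw [← sub_eq_iff_eq_add', ← Finset.sum_sub_distrib, Finset.sum_eq_single j]
      · rw [x_eq, x_eq, h_updFwd h2, if_pos rfl]; ring
      · intro k _ hk
        rw [x_eq, x_eq, h_updFwd h2, if_neg hk, add_zero, sub_self]
      · simp
    rw [e1]
    ring
  · rw [dx_of_not_lt M hl, dx_of_not_lt M hl, outWeight_eq, outWeight_eq]
    simp only [newestCoeff, if_neg hl, e, mul_zero, add_zero]
    rfl

lemma pderivFwd_dh (hφ : GoodActivation M.φ) {t l : ℕ} (h2 : 2 ≤ l) (i j : Fin M.m)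
    (ω : Noise M.d M.m) :
    pderivFwd t j (M.dh l t i) ω =
      M.newestCoeff l t i j * (deriv M.φ (M.h l t j ω) * deriv M.φ (M.h l t i ω)) +
        if i = j then M.dx l t i ω * deriv (deriv M.φ) (M.h l t i ω) else 0 := by
  have h1 : HasDerivAt (fun c => M.φ (M.h l t j ω + (c - ω.fwd t j)))
      (deriv M.φ (M.h l t j ω)) (ω.fwd t j) :=
    hasDerivAt_comp_add_sub (differentiable_of_good hφ _).hasDerivAt _
  have h3 : HasDerivAt (fun c => deriv M.φ (M.h l t i ω + if i = j then c - ω.fwd t j else 0))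
      (if i = j then deriv (deriv M.φ) (M.h l t i ω) else 0) (ω.fwd t j) := by
    split_ifs with hij
    · exact hasDerivAt_comp_add_sub (differentiable_deriv_of_good hφ _).hasDerivAt _
    · exact hasDerivAt_const _ _
  have h4 := (((h1.sub_const (M.φ (M.h l t j ω))).mul_const (M.newestCoeff l t i j)).const_add
    (M.dx l t i ω)).mul h3
  rw [pderivFwd_eq]
  have e : (fun c => M.dh l t i (updFwd t j c ω)) = fun c => (M.dx l t i ω +
      (M.φ (M.h l t j ω + (c - ω.fwd t j)) - M.φ (M.h l t j ω)) * M.newestCoeff l t i j) *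
        deriv M.φ (M.h l t i ω + if i = j then c - ω.fwd t j else 0) := by
    ext c
    rw [dh_eq, h_updFwd h2, dx_updFwd h2]
  rw [e]
  refine h4.deriv.trans ?_
  simp only [sub_self, add_zero, zero_mul, ite_self]
  split_ifs <;> ring

/-- When no weight moves in step `t`, the Gaussians `fwd t` enter `dh_{t+1}^l` only through the features
of time `t`. -/
lemma pderivFwd_dh_succ_of_stall (hφ : GoodActivation M.φ) {t l : ℕ} (h2 : 2 ≤ l)
    (hχ : ∀ j, M.χ t j = 0) (hl : l < M.L → M.StallBwd t (l + 1)) (i j : Fin M.m)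
    (ω : Noise M.d M.m) :
    pderivFwd t j (M.dh l (t + 1) i) ω = (M.newestCoeff l t i j - M.newestCoeff l (t + 1) i j) *
      (deriv M.φ (M.h l t j ω) * deriv M.φ (M.h l (t + 1) i ω)) := by
  have hh : ∀ k c, M.h l (t + 1) k (updFwd t j c ω) = M.h l (t + 1) k ω := by
    intro k c
    rw [h_succ_of_stall hχ fun _ => stallFwd hφ hχ _, h_succ_of_stall hχ fun _ => stallFwd hφ hχ _,
      h_updFwd h2, if_pos h2, if_pos h2, fwd_updFwd, fwd_updFwd,
      if_neg (show t + 1 ≠ t by omega), if_pos (rfl : t = t)]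
    by_cases hk : k = j
    · subst hk; simp; ring
    · simp [hk]
  have hdx : ∀ c, M.dx l (t + 1) i (updFwd t j c ω) = M.dx l (t + 1) i ω +
      (M.φ (M.h l t j ω + (c - ω.fwd t j)) - M.φ (M.h l t j ω)) *
        (M.newestCoeff l t i j - M.newestCoeff l (t + 1) i j) := by
    intro c
    rw [dx_succ_of_stall hχ hl, dx_succ_of_stall hχ hl, dx_updFwd h2, bwd_updFwd]
    have e1 : ∑ k, (M.x l (t + 1) k (updFwd t j c ω) - M.x l t k (updFwd t j c ω)) *
          M.newestCoeff l (t + 1) i k =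
        ∑ k, (M.x l (t + 1) k ω - M.x l t k ω) * M.newestCoeff l (t + 1) i k -
        (M.φ (M.h l t j ω + (c - ω.fwd t j)) - M.φ (M.h l t j ω)) *
          M.newestCoeff l (t + 1) i j := by
      rw [eq_sub_iff_add_eq, ← eq_sub_iff_add_eq', ← Finset.sum_sub_distrib,
        Finset.sum_eq_single j]
      · rw [x_eq, x_eq, x_eq, x_eq, hh, h_updFwd h2, if_pos rfl]; ring
      · intro k _ hk
        rw [x_eq, x_eq, x_eq, x_eq, hh, h_updFwd h2, if_neg hk, add_zero, sub_self]
      · simp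
    rw [e1]
    ring
  have h1 : HasDerivAt (fun c => M.φ (M.h l t j ω + (c - ω.fwd t j)))
      (deriv M.φ (M.h l t j ω)) (ω.fwd t j) :=
    hasDerivAt_comp_add_sub (differentiable_of_good hφ _).hasDerivAt _
  have h4 := (((h1.sub_const (M.φ (M.h l t j ω))).mul_const
    (M.newestCoeff l t i j - M.newestCoeff l (t + 1) i j)).const_add
    (M.dx l (t + 1) i ω)).mul_const (deriv M.φ (M.h l (t + 1) i ω))
  rw [pderivFwd_eq]
  have e : (fun c => M.dh l (t + 1) i (updFwd t j c ω)) = fun c => (M.dx l (t + 1) i ω +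
      (M.φ (M.h l t j ω + (c - ω.fwd t j)) - M.φ (M.h l t j ω)) *
        (M.newestCoeff l t i j - M.newestCoeff l (t + 1) i j)) *
        deriv M.φ (M.h l (t + 1) i ω) := by
    ext c
    rw [dh_eq, hh, hdx]
  rw [e]
  refine h4.deriv.trans ?_
  ring

lemma integrable_pderivFwd_dh (hφ : GoodActivation M.φ) {t l p q : ℕ} (h2 : 2 ≤ l)
    (i j : Fin M.m) : Integrable (pderivFwd t j (M.dh l t i)) (M.law l p q) := by
  obtain ⟨C, hC⟩ := hφ.deriv_bounded
  obtain ⟨C', hC'⟩ := hφ.deriv2_bounded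
  have hh := (continuous_h_dx hφ t).1 l
  have c1 := continuous_deriv_of_good hφ
  have c2 := continuous_deriv_deriv_of_good hφ
  rw [funext (pderivFwd_dh hφ h2 i j)]
  refine Integrable.add (Integrable.const_mul ?_ _) ?_
  · refine Integrable.of_bound (C := C * C) ?_ (ae_of_all _ fun ω => ?_)
    · exact ((c1.comp (hh j)).mul (c1.comp (hh i))).aestronglyMeasurable
    · rw [norm_mul]
      exact mul_le_mul (hC _) (hC _) (norm_nonneg _) ((abs_nonneg _).trans (hC 0))
  · split_ifs
    · exact (((memLp_h_dx _ _ hφ t).2 l i).integrable (by norm_num)).mul_bdd (c := C')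
        (c2.comp (hh i)).aestronglyMeasurable (ae_of_all _ fun ω => hC' _)
    · exact integrable_zero _ _ _

lemma integrable_pderivFwd_dh_succ_of_stall (hφ : GoodActivation M.φ) {t l p q : ℕ} (h2 : 2 ≤ l)
    (hχ : ∀ j, M.χ t j = 0) (hl : l < M.L → M.StallBwd t (l + 1)) (i j : Fin M.m) :
    Integrable (pderivFwd t j (M.dh l (t + 1) i)) (M.law l p q) := by
  obtain ⟨C, hC⟩ := hφ.deriv_bounded
  have hh := (continuous_h_dx hφ t).1 l
  have hh' := (continuous_h_dx hφ (t + 1)).1 l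
  have c1 := continuous_deriv_of_good hφ
  rw [funext (pderivFwd_dh_succ_of_stall hφ h2 hχ hl i j)]
  refine Integrable.const_mul ?_ _
  refine Integrable.of_bound (C := C * C) ?_ (ae_of_all _ fun ω => ?_)
  · exact ((c1.comp (hh j)).mul (c1.comp (hh' i))).aestronglyMeasurable
  · rw [norm_mul]
    exact mul_le_mul (hC _) (hC _) (norm_nonneg _) ((abs_nonneg _).trans (hC 0))

/-- Where the Gaussians of times `t` and `t + 1` agree, nothing changes in a step without error
signal. -/
lemma h_dx_succ_eq_of_stall (hφ : GoodActivation M.φ) {t l : ℕ} (hχ : ∀ j, M.χ t j = 0)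
    (hl : l < M.L → M.StallBwd t (l + 1)) (ω : Noise M.d M.m)
    (hf : 2 ≤ l → ω.fwd (t + 1) = ω.fwd t) (hb : l < M.L → ω.bwd (t + 1) = ω.bwd t) (i : Fin M.m) :
    M.h l (t + 1) i ω = M.h l t i ω ∧ M.dx l (t + 1) i ω = M.dx l t i ω := by
  have hh : ∀ i, M.h l (t + 1) i ω = M.h l t i ω := by
    intro i
    rw [h_succ_of_stall hχ fun _ => stallFwd hφ hχ _]
    split_ifs with h2
    · rw [hf h2]; simp
    · simp
  refine ⟨hh i, ?_⟩
  rw [dx_succ_of_stall hχ hl]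
  simp only [x_eq, hh, sub_self, zero_mul, Finset.sum_const_zero, add_zero]
  split_ifs with h2
  · rw [hb h2]; simp
  · simp

lemma stallBwd_of_stallBwd_succ (hφ : GoodActivation M.φ) {t l : ℕ} (h2 : 2 ≤ l)
    (hχ : ∀ j, M.χ t j = 0) (hl : l < M.L → M.StallBwd t (l + 1)) : M.StallBwd t l := by
  have hdh : ∀ ω : Noise M.d M.m, ω.fwd (t + 1) = ω.fwd t →
      (l < M.L → ω.bwd (t + 1) = ω.bwd t) → ∀ i, M.dh l (t + 1) i ω = M.dh l t i ω := by
    intro ω hf hb i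
    obtain ⟨e1, e2⟩ := h_dx_succ_eq_of_stall hφ hχ hl ω (fun _ => hf) hb i
    rw [dh_eq, dh_eq, e1, e2]
  have hae : ∀ᵐ ω ∂(M.law l (t + 1 + 1) (t + 1 + 1)), ω.fwd (t + 1) = ω.fwd t ∧
      (l < M.L → ω.bwd (t + 1) = ω.bwd t) := by
    have hb : ∀ᵐ ω ∂(M.law l (t + 1 + 1) (t + 1 + 1)), l < M.L → ω.bwd (t + 1) = ω.bwd t := by
      by_cases hlL : l < M.L
      · filter_upwards [ae_bwd_succ_of_stall hφ (p := t + 1 + 1) hlL (hl hlL) le_rfl]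
          with ω hω _ using hω
      · exact ae_of_all _ fun ω h => absurd h hlL
    filter_upwards [ae_fwd_succ_of_stall hφ (q := t + 1 + 1) h2 (stallFwd hφ hχ _) le_rfl, hb]
      with ω h1 h2 using ⟨h1, h2⟩
  have hdep : ∀ s ≤ t, ∀ r ≤ t, ∀ i j,
      DependsUpTo (max s r + 1) (max s r + 1) fun ω => M.dh l s i ω * M.dh l r j ω := by
    intro s hs r hr i j ω ω' h1 h2 h3 h4
    dsimp only
    rw [(M.dependsUpTo_dh l s i).mono (by omega) (by omega) ω ω' h1 h2 h3 h4,
      (M.dependsUpTo_dh l r j).mono (by omega) (by omega) ω ω' h1 h2 h3 h4]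
  have hm : ∀ s r i j, Measurable fun ω => M.dh l s i ω * M.dh l r j ω := fun s r i j =>
    ((continuous_dh hφ _ _ _).mul (continuous_dh hφ _ _ _)).measurable
  refine ⟨fun s hs j i => ?_, fun i j => ?_, fun s hs i j => ?_, fun i j => ?_⟩
  · rw [gramDH_eq, gramDH_eq, max_eq_right (by omega : s ≤ t + 1),
      integral_law hφ (p' := t + 1 + 1) (q' := t + 1 + 1) (by omega) (by omega) (hm _ _ _ _)
        (hdep s hs t le_rfl j i)]
    refine integral_congr_ae ?_
    filter_upwards [hae] with ω hω
    rw [hdh ω hω.1 hω.2]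
  · rw [gramDH_eq, gramDH_eq, max_self,
      integral_law hφ (p' := t + 1 + 1) (q' := t + 1 + 1) (by omega) (by omega) (hm _ _ _ _)
        (hdep t le_rfl t le_rfl i j)]
    refine integral_congr_ae ?_
    filter_upwards [hae] with ω hω
    rw [hdh ω hω.1 hω.2, hdh ω hω.1 hω.2]
  · rw [meanPderivDH_eq, meanPderivDH_eq,
      integral_law hφ (p' := t + 1 + 1) (q' := t + 1 + 1) (by omega) (by omega)
        (measurable_pderivFwd s j (continuous_dh hφ l t i))
        ((M.dependsUpTo_dh l t i).pderivFwd (by omega))]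
    refine integral_congr_ae ?_
    filter_upwards [hae] with ω hω
    rw [pderivFwd_eq, pderivFwd_eq]
    congr 1
    ext c
    refine hdh (updFwd s j c ω) ?_ hω.2 i
    rw [fwd_updFwd, fwd_updFwd, if_neg (by omega), if_neg (by omega), hω.1]
  · rw [meanPderivDH_eq, meanPderivDH_eq, meanPderivDH_eq,
      integral_law hφ (p := t + 1) (p' := t + 1 + 1) (q' := t + 1 + 1) (by omega) (by omega)
        (measurable_pderivFwd t j (continuous_dh hφ l t i))
        ((M.dependsUpTo_dh l t i).pderivFwd (by omega)),
      ← integral_add (integrable_pderivFwd_dh_succ_of_stall hφ h2 hχ hl i j)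
        (integrable_pderivFwd_dh hφ h2 i j)]
    refine integral_congr_ae ?_
    filter_upwards [hae] with ω hω
    have e := h_dx_succ_eq_of_stall hφ hχ hl ω (fun _ => hω.1) hω.2
    rw [pderivFwd_dh hφ h2, pderivFwd_dh hφ h2, pderivFwd_dh_succ_of_stall hφ h2 hχ hl,
      (e i).1, (e j).1, (e i).2]
    ring

lemma stallBwd (hφ : GoodActivation M.φ) {t : ℕ} (hχ : ∀ j, M.χ t j = 0) {l : ℕ} (h2 : 2 ≤ l) :
    M.StallBwd t l := by
  induction hk : M.L - l generalizing l with
  | zero => exact stallBwd_of_stallBwd_succ hφ h2 hχ (by omega)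
  | succ k ih =>
    exact stallBwd_of_stallBwd_succ hφ h2 hχ fun _ => ih (by omega) (by omega)

/-- In a step without error signal the features do not change, almost surely. -/
lemma ae_x_succ_of_stall (hφ : GoodActivation M.φ) {t l p q : ℕ} (hχ : ∀ j, M.χ t j = 0)
    (hp : t + 2 ≤ p) : ∀ᵐ ω ∂(M.law l p q), ∀ i, M.x l (t + 1) i ω = M.x l t i ω := by
  by_cases h2 : 2 ≤ l
  · filter_upwards [ae_fwd_succ_of_stall hφ (q := q) h2 (stallFwd hφ hχ _) hp] with ω hω i
    rw [x_eq, x_eq, h_succ_of_stall hχ fun _ => stallFwd hφ hχ _, if_pos h2, hω, sub_self,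
      add_zero]
  · refine ae_of_all _ fun ω i => ?_
    rw [x_eq, x_eq, h_succ_of_stall hχ fun _ => stallFwd hφ hχ _, if_neg h2, add_zero]

end MLPTraining

/-! ### One-variable arguments -/

lemma sum_mul_deriv_eq_zero {ι : Type*} [Fintype ι] {f f' : ℝ → ℝ}
    (hf : ∀ a, HasDerivAt f (f' a) a) (c b z : ι → ℝ)
    (h : ∀ ε : ℝ, ∑ a, c a * f (b a + ε * z a) = 0) : ∑ a, c a * (f' (b a) * z a) = 0 := by
  have h1 : ∀ a, HasDerivAt (fun ε : ℝ => f (b a + ε * z a)) (f' (b a) * z a) 0 := by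
    intro a
    have e : HasDerivAt (fun ε : ℝ => b a + ε * z a) (z a) 0 := by
      simpa using ((hasDerivAt_id (0 : ℝ)).mul_const (z a)).const_add (b a)
    have e' : HasDerivAt f (f' (b a)) (b a + 0 * z a) := by
      rw [zero_mul, add_zero]; exact hf _
    exact HasDerivAt.comp 0 e' e
  have h2 : HasDerivAt (fun ε : ℝ => ∑ a, c a * f (b a + ε * z a))
      (∑ a, c a * (f' (b a) * z a)) 0 :=
    HasDerivAt.fun_sum fun a _ => (h1 a).const_mul (c a)
  simp only [h] at h2
  exact h2.unique (hasDerivAt_const _ _)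

lemma exists_forall_inner_ne_zero {ι E : Type*} [Finite ι] [NormedAddCommGroup E]
    [InnerProductSpace ℝ E] (v : ι → E) (hv : ∀ i, v i ≠ 0) :
    ∃ u : E, ∀ i, inner ℝ u (v i) ≠ 0 := by
  obtain ⟨u, hu⟩ := Module.Dual.exists_forall_ne_zero_of_forall_exists
    (fun i => innerₗ E (v i)) fun i => ⟨v i, by simpa using hv i⟩
  exact ⟨u, fun i => by rw [real_inner_comm]; exact hu i⟩

/-- In a generic direction the inputs have projections of pairwise distinct, nonzero modulus. -/
lemma GenericInputs.exists_direction {d m : ℕ} {ξ : Fin m → EuclideanSpace ℝ (Fin d)}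
    (hξ : GenericInputs ξ) :
    ∃ u : EuclideanSpace ℝ (Fin d), (∀ i, inner ℝ u (ξ i) ≠ 0) ∧
      ∀ i j, i ≠ j → |inner ℝ u (ξ i)| ≠ |inner ℝ u (ξ j)| := by
  have h0 : ∀ i, ξ i ≠ 0 := fun i h => hξ.ne_neg i i (by rw [h, neg_zero])
  obtain ⟨u, hu⟩ := exists_forall_inner_ne_zero
    (fun a : Fin m ⊕ (Fin m × Fin m) ⊕ {a : Fin m × Fin m // a.1 ≠ a.2} =>
      Sum.elim ξ (Sum.elim (fun a => ξ a.1 + ξ a.2) (fun a => ξ a.1.1 - ξ a.1.2)) a) (by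
      rintro (i | a | a)
      · exact h0 i
      · exact fun h => hξ.ne_neg a.1 a.2 (eq_neg_of_add_eq_zero_left h)
      · exact sub_ne_zero.mpr fun h => a.2 (hξ.injective h))
  refine ⟨u, fun i => hu (.inl i), fun i j hij h => ?_⟩
  have h1 := hu (.inr (.inl (i, j)))
  have h2 := hu (.inr (.inr ⟨(i, j), hij⟩))
  simp only [Sum.elim_inr, Sum.elim_inl, inner_add_right, inner_sub_right] at h1 h2
  rcases abs_eq_abs.mp h with h | h
  · exact h2 (by rw [h, sub_self])
  · exact h1 (by rw [h, neg_add_cancel])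

lemma GoodActivation.exists_deriv_ne_zero {φ : ℝ → ℝ} (hφ : GoodActivation φ) :
    ∃ a, deriv φ a ≠ 0 := by
  by_contra! h
  refine Cardinal.not_countable_real ?_
  simpa [h] using hφ.deriv_level_countable 0

lemma GoodActivation.exists_deriv_deriv_ne_zero {φ : ℝ → ℝ} (hφ : GoodActivation φ) :
    ∃ a, deriv (deriv φ) a ≠ 0 := by
  by_contra! h
  have hc := is_const_of_deriv_eq_zero (MLPTraining.differentiable_deriv_of_good hφ) h
  refine Cardinal.not_countable_real ?_
  have := hφ.deriv_level_countable (deriv φ 0)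
  simpa [hc _ 0] using this

namespace MLPTraining

open Noise

variable {M : MLPTraining}

/-! ### Admissible families and linear independence -/

variable (M) in
/-- Families that stand still in the steps without error signal. -/
def Admissible (z : ℕ → Fin M.m → ℝ) : Prop :=
  ∀ s, (∀ j, M.χ s j = 0) → z (s + 1) = z s

variable (M) in
/-- The only linear relations between the features `x_s^l(ξ_i)`, `s ≤ n`, are those imposed by the
steps without error signal. -/
def IndepX (l n : ℕ) : Prop :=
  ∀ c : Fin (n + 1) × Fin M.m → ℝ,
    (∀ᵐ ω ∂(M.law l (n + 1) n), ∑ a, c a * M.x l a.1 a.2 ω = 0) →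
      ∀ z, M.Admissible z → ∑ a, c a * z a.1 a.2 = 0

variable (M) in
/-- The only linear relations between the backpropagated vectors `dh_s^l(ξ_i)`, `s ≤ n`, are those
imposed by the steps without error signal. -/
def IndepDH (l n : ℕ) : Prop :=
  ∀ c : Fin (n + 1) × Fin M.m → ℝ,
    (∀ᵐ ω ∂(M.law l (n + 1) (n + 1)), ∑ a, c a * M.dh l a.1 a.2 ω = 0) →
      ∀ z, M.Admissible z → ∑ a, c a * z a.1 a.2 = 0

/-- A pair of families that is a value of `(h^l, dx^l)` at a point of the support of the noise of
layer `l`. In the hidden layers `2 ≤ l < L` there is no constraint besides admissibility: the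
Gaussians can absorb all other terms of the recursion. -/
structure IsProfile (M : MLPTraining) (l : ℕ) (H D : ℕ → Fin M.m → ℝ) : Prop where
  adm_h : M.Admissible H
  adm_dx : M.Admissible D
  input : ¬ 2 ≤ l → ∃ W : EuclideanSpace ℝ (Fin M.d), ∀ t i, H t i = inner ℝ W (M.ξ i)
    - M.η * ∑ s : Fin t, ∑ j : Fin M.m,
      M.χ s j * inner ℝ (M.ξ j) (M.ξ i) * (D s j * deriv M.φ (H s j))
  output : ¬ l < M.L → ∃ o : ℝ, ∀ t i, D t i =
    o - M.η * ∑ s : Fin t, ∑ j : Fin M.m, M.χ s j * M.φ (H s j)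

/-- Every profile is realized by a noise in the support: each free Gaussian is the prescribed value
minus the other terms of its recursion, and these are admissible because the coefficients stand still
in the steps without error signal. -/
lemma IsProfile.exists_noise (hφ : GoodActivation M.φ) {l : ℕ} (hl1 : 1 ≤ l) (hlL : l ≤ M.L)
    {H D : ℕ → Fin M.m → ℝ} (hP : M.IsProfile l H D) :
    ∃ ω : Noise M.d M.m, (∀ t i, M.h l t i ω = H t i ∧ M.dx l t i ω = D t i) ∧
      (2 ≤ l → M.Admissible ω.fwd) ∧ (¬ 2 ≤ l → ω.fwd = 0) ∧
      (l < M.L → M.Admissible ω.bwd) ∧ (¬ l < M.L → ω.bwd = 0) := by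
  obtain ⟨W, hW⟩ : ∃ W : EuclideanSpace ℝ (Fin M.d), ¬ 2 ≤ l → ∀ t i, H t i =
      inner ℝ W (M.ξ i) - M.η * ∑ s : Fin t, ∑ j : Fin M.m,
        M.χ s j * inner ℝ (M.ξ j) (M.ξ i) * (D s j * deriv M.φ (H s j)) := by
    by_cases h2 : 2 ≤ l
    · exact ⟨0, fun h => absurd h2 h⟩
    · obtain ⟨W, hW⟩ := hP.input h2
      exact ⟨W, fun _ => hW⟩
  obtain ⟨o, ho⟩ : ∃ o : ℝ, ¬ l < M.L → ∀ t i, D t i =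
      o - M.η * ∑ s : Fin t, ∑ j : Fin M.m, M.χ s j * M.φ (H s j) := by
    by_cases h2 : l < M.L
    · exact ⟨0, fun h => absurd h2 h⟩
    · obtain ⟨o, ho⟩ := hP.output h2
      exact ⟨o, fun _ => ho⟩
  let f : ℕ → Fin M.m → ℝ := fun t i => if 2 ≤ l then H t i
      - ∑ j : Fin M.m, ∑ s : Fin t, (D s j * deriv M.φ (H s j)) * M.meanPderivX (l - 1) t i s j
      + M.η * ∑ s : Fin t, ∑ j : Fin M.m,
          M.χ s j * (D s j * deriv M.φ (H s j)) * M.gramX (l - 1) s j t i else 0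
  let b : ℕ → Fin M.m → ℝ := fun t i => if l < M.L then D t i
      - ∑ j : Fin M.m, ∑ s : Fin (t + 1), M.φ (H s j) * M.meanPderivDH (l + 1) t i s j
      + M.η * ∑ s : Fin t, ∑ j : Fin M.m,
          M.χ s j * M.φ (H s j) * M.gramDH (l + 1) s j t i else 0
  have key : ∀ t i, M.h l t i (W, o, f, b) = H t i ∧ M.dx l t i (W, o, f, b) = D t i := by
    intro t
    induction t using Nat.strong_induction_on with
    | _ t ih =>
      have hdh : ∀ (s : Fin t) j, M.dh l s j (W, o, f, b) = D s j * deriv M.φ (H s j) := by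
        intro s j
        rw [dh_eq, (ih s s.2 j).1, (ih s s.2 j).2]
      have hh : ∀ i, M.h l t i (W, o, f, b) = H t i := by
        intro i
        by_cases h2 : 2 ≤ l
        · rw [h_of_two_le M h2]
          simp only [hdh]
          simp only [Noise.fwd, f, if_pos h2]
          ring
        · rw [h_of_lt_two M h2, hW h2]
          simp only [hdh, Noise.inW]
      intro i
      refine ⟨hh i, ?_⟩
      have hx : ∀ (s : Fin t) j, M.x l s j (W, o, f, b) = M.φ (H s j) := by
        intro s j
        rw [x_eq, (ih s s.2 j).1]
      have hx' : ∀ (s : Fin (t + 1)) j, M.x l s j (W, o, f, b) = M.φ (H s j) := by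
        intro s j
        rw [x_eq]
        rcases (Nat.lt_succ_iff.mp s.2).eq_or_lt with hs | hs
        · rw [hs, hh]
        · rw [(ih s hs j).1]
      by_cases h2 : l < M.L
      · rw [dx_of_lt M h2]
        simp only [hx, hx']
        simp only [Noise.bwd, b, if_pos h2]
        ring
      · obtain rfl : l = M.L := by omega
        rw [dx_of_not_lt M h2, outWeight_eq, ho h2]
        simp only [hx, Noise.outW]
  refine ⟨(W, o, f, b), key, fun h2 t hχ => ?_, fun h2 => ?_, fun h2 t hχ => ?_, fun h2 => ?_⟩
  · have hs := stallFwd hφ hχ (l - 1)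
    have e1 : ∀ i (s : Fin t) j, M.meanPderivX (l - 1) (t + 1) i s j =
        M.meanPderivX (l - 1) t i s j := fun i s j => hs.pderiv_lt s s.2 i j
    have e2 : ∀ i (s : Fin t) j, M.gramX (l - 1) s j (t + 1) i = M.gramX (l - 1) s j t i :=
      fun i s j => hs.gram_le s s.2.le j i
    ext i
    simp only [Noise.fwd, f, if_pos h2]
    simp only [Fin.sum_univ_castSucc, Fin.val_castSucc, Fin.val_last, hs.pderiv_self, hχ, mul_zero,
      zero_mul, add_zero, Finset.sum_const_zero, e1, e2, hP.adm_h t hχ]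
  · ext t i
    simp only [Noise.fwd, f, if_neg h2]; rfl
  · have hs := stallBwd hφ hχ (l := l + 1) (by omega)
    have e1 : ∀ i (s : Fin t) j, M.meanPderivDH (l + 1) (t + 1) i s j =
        M.meanPderivDH (l + 1) t i s j := fun i s j => hs.pderiv_lt s s.2 i j
    have e2 : ∀ i (s : Fin t) j, M.gramDH (l + 1) s j (t + 1) i = M.gramDH (l + 1) s j t i :=
      fun i s j => hs.gram_le s s.2.le j i
    ext i
    simp only [Noise.bwd, b, if_pos h2]
    simp only [Fin.sum_univ_castSucc, Fin.val_castSucc, Fin.val_last, hχ,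
      zero_mul, add_zero, Finset.sum_const_zero, e1, e2, hP.adm_h t hχ, hP.adm_dx t hχ,
      ← hs.pderiv_add, mul_add, add_assoc]
  · ext t i
    simp only [Noise.bwd, b, if_neg h2]; rfl

/-- By linear independence of the features of the previous layer and of the backpropagated vectors
of the next layer, the support of the noise contains all admissible families. -/
lemma eq_zero_of_ae_law (hφ : GoodActivation M.φ) {l n q : ℕ}
    (hX : 2 ≤ l → M.IndepX (l - 1) n) (hDH : l < M.L → ∀ k, q = k + 1 → M.IndepDH (l + 1) k)
    {F : Noise M.d M.m → ℝ} (hF : Continuous F) (hdep : DependsUpTo (n + 1) q F)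
    (h0 : ∀ᵐ ω ∂(M.law l (n + 1) q), F ω = 0) (ω : Noise M.d M.m)
    (hf : 2 ≤ l → M.Admissible ω.fwd) (hf0 : ¬ 2 ≤ l → ω.fwd = 0)
    (hb : l < M.L → M.Admissible ω.bwd) (hb0 : ¬ l < M.L → ω.bwd = 0) : F ω = 0 := by
  refine eq_zero_of_ae_layerLaw ((posSemidef_cov hφ _).1 l) ((posSemidef_cov hφ _).2 l) hF hdep h0
    ω (fun c hc => ?_) (fun c hc => ?_)
  · by_cases h2 : 2 ≤ l
    · exact hX h2 c (ae_sum_eq_zero_of_dotProduct_gram (fun a => memLp_x _ _ hφ _ _ _)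
        (covFwd_eq_integral hφ h2 ((posSemidef_cov hφ _).1 _) ((posSemidef_cov hφ _).2 _)) hc)
        _ (hf h2)
    · simp [hf0 h2]
  · by_cases h2 : l < M.L
    · cases q with
      | zero => exact Finset.sum_eq_zero fun a _ => a.1.elim0
      | succ k =>
        exact hDH h2 k rfl c (ae_sum_eq_zero_of_dotProduct_gram (fun a => memLp_dh _ _ hφ _ _ _)
          (covBwd_eq_integral hφ h2 ((posSemidef_cov hφ _).1 _) ((posSemidef_cov hφ _).2 _)) hc)
          _ (hb h2)
    · simp [hb0 h2]

lemma sum_mul_x_profile (hφ : GoodActivation M.φ) {l n : ℕ} (hl1 : 1 ≤ l) (hlL : l ≤ M.L)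
    (hX : 2 ≤ l → M.IndepX (l - 1) n) (hDH : l < M.L → ∀ k, n = k + 1 → M.IndepDH (l + 1) k)
    {c : Fin (n + 1) × Fin M.m → ℝ}
    (h0 : ∀ᵐ ω ∂(M.law l (n + 1) n), ∑ a, c a * M.x l a.1 a.2 ω = 0)
    {H D : ℕ → Fin M.m → ℝ} (hP : M.IsProfile l H D) :
    ∑ a, c a * M.φ (H a.1 a.2) = 0 := by
  obtain ⟨ω, hω, hf, hf0, hb, hb0⟩ := hP.exists_noise hφ hl1 hlL
  have hx := continuous_x hφ (M := M)
  have := eq_zero_of_ae_law hφ hX hDH (F := fun ω => ∑ a, c a * M.x l a.1 a.2 ω) (by fun_prop)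
    (fun ω ω' h1 h2 h3 h4 => Finset.sum_congr rfl fun a _ => by
      have ha := a.1.2
      rw [(M.dependsUpTo_x l a.1 a.2).mono (by omega) (by omega) ω ω' h1 h2 h3 h4])
    h0 ω hf hf0 hb hb0
  simpa only [x_eq, (hω _ _).1] using this

lemma sum_mul_dh_profile (hφ : GoodActivation M.φ) {l n : ℕ} (hl1 : 1 ≤ l) (hlL : l ≤ M.L)
    (hX : 2 ≤ l → M.IndepX (l - 1) n) (hDH : l < M.L → M.IndepDH (l + 1) n)
    {c : Fin (n + 1) × Fin M.m → ℝ}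
    (h0 : ∀ᵐ ω ∂(M.law l (n + 1) (n + 1)), ∑ a, c a * M.dh l a.1 a.2 ω = 0)
    {H D : ℕ → Fin M.m → ℝ} (hP : M.IsProfile l H D) :
    ∑ a, c a * (D a.1 a.2 * deriv M.φ (H a.1 a.2)) = 0 := by
  obtain ⟨ω, hω, hf, hf0, hb, hb0⟩ := hP.exists_noise hφ hl1 hlL
  have hx := continuous_dh hφ (M := M)
  have := eq_zero_of_ae_law hφ hX
    (fun h k hk => by obtain rfl : n = k := by omega
                      exact hDH h)
    (F := fun ω => ∑ a, c a * M.dh l a.1 a.2 ω) (by fun_prop)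
    (fun ω ω' h1 h2 h3 h4 => Finset.sum_congr rfl fun a _ => by
      have ha := a.1.2
      rw [(M.dependsUpTo_dh l a.1 a.2).mono (by omega) (by omega) ω ω' h1 h2 h3 h4])
    h0 ω hf hf0 hb hb0
  simpa only [dh_eq, (hω _ _).1, (hω _ _).2] using this

lemma Admissible.affine {z : ℕ → Fin M.m → ℝ} (hz : M.Admissible z) (a ε : ℝ) :
    M.Admissible fun t i => a + ε * z t i := by
  intro s hs
  ext i
  simp only [hz s hs]

lemma admissible_outWeight (o : ℝ) (H : ℕ → Fin M.m → ℝ) : M.Admissible fun t _ =>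
    o - M.η * ∑ s : Fin t, ∑ j : Fin M.m, M.χ s j * M.φ (H s j) := by
  intro s hs
  ext i
  simp only [Fin.sum_univ_castSucc, Fin.val_castSucc, Fin.val_last, hs, zero_mul, add_zero,
    Finset.sum_const_zero]

/-- Profiles of the layers `l ≥ 2`: the preactivations are free. -/
lemma isProfile_of_two_le {l : ℕ} (hl : 2 ≤ l) {H : ℕ → Fin M.m → ℝ} (hH : M.Admissible H)
    (o : ℝ) : M.IsProfile l H fun t _ =>
      o - M.η * ∑ s : Fin t, ∑ j : Fin M.m, M.χ s j * M.φ (H s j) :=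
  ⟨hH, admissible_outWeight o H, fun h => absurd hl h, fun _ => ⟨o, fun _ _ => rfl⟩⟩

lemma indepX_of_two_le (hφ : GoodActivation M.φ) {l n : ℕ} (hl2 : 2 ≤ l) (hlL : l ≤ M.L)
    (hX : M.IndepX (l - 1) n) (hDH : l < M.L → ∀ k, n = k + 1 → M.IndepDH (l + 1) k) :
    M.IndepX l n := by
  intro c h0 z hz
  obtain ⟨a, ha⟩ := hφ.exists_deriv_ne_zero
  have h := sum_mul_deriv_eq_zero (fun a => (differentiable_of_good hφ a).hasDerivAt) c
    (fun _ => a) (fun b => z b.1 b.2) fun ε =>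
      sum_mul_x_profile hφ (by omega) hlL (fun _ => hX) hDH h0
        (isProfile_of_two_le hl2 (hz.affine a ε) 0)
  simp only [mul_left_comm _ (deriv M.φ a), ← Finset.mul_sum] at h
  exact (mul_eq_zero.mp h).resolve_left ha

lemma indepDH_of_lt (hφ : GoodActivation M.φ) {l n : ℕ} (hl2 : 2 ≤ l) (hlL : l < M.L)
    (hX : M.IndepX (l - 1) n) (hDH : M.IndepDH (l + 1) n) : M.IndepDH l n := by
  intro c h0 z hz
  obtain ⟨a, ha⟩ := hφ.exists_deriv_ne_zero
  have hP : M.IsProfile l (fun _ _ => a) z :=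
    ⟨fun _ _ => rfl, hz, fun h => absurd hl2 h, fun h => absurd hlL h⟩
  have h := sum_mul_dh_profile hφ (by omega) hlL.le (fun _ => hX) (fun _ => hDH) h0 hP
  simp only [← mul_assoc, ← Finset.sum_mul] at h
  exact (mul_eq_zero.mp h).resolve_right ha

lemma indepDH_last (hφ : GoodActivation M.φ) {n : ℕ} (hL : 2 ≤ M.L)
    (hX : M.IndepX (M.L - 1) n) : M.IndepDH M.L n := by
  intro c h0 z hz
  obtain ⟨a, ha⟩ := hφ.exists_deriv_deriv_ne_zero
  have h := sum_mul_deriv_eq_zero (fun a => (differentiable_deriv_of_good hφ a).hasDerivAt) c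
    (fun _ => a) (fun b => z b.1 b.2) fun ε => by
      have hP := fun o => sum_mul_dh_profile hφ (by omega) le_rfl (fun _ => hX)
        (fun h => absurd h (lt_irrefl _)) h0 (isProfile_of_two_le hL (hz.affine a ε) o)
      -- The relation is affine in the initial output weight; this is its slope.
      have := sub_eq_zero.mpr ((hP 1).trans (hP 0).symm)
      rw [← Finset.sum_sub_distrib] at this
      rw [← this]
      exact Finset.sum_congr rfl fun b _ => by ring
  simp only [mul_left_comm _ (deriv (deriv M.φ) a), ← Finset.mul_sum] at h
  exact (mul_eq_zero.mp h).resolve_left ha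

/-! ### The first layer -/

variable (M) in
/-- A backpropagated vector equal to `ε` at sample `j` during the maximal run of steps that ends with
step `r` and has no error signal before step `r`, and zero otherwise. -/
noncomputable def pulse (r : ℕ) (j : Fin M.m) (ε : ℝ) : ℕ → Fin M.m → ℝ := fun s k =>
  open scoped Classical in
  if k = j ∧ s ≤ r ∧ ∀ r', s ≤ r' → r' < r → ∀ k, M.χ r' k = 0 then ε else 0

lemma admissible_pulse {r : ℕ} {j : Fin M.m} (hr : M.χ r j ≠ 0) (ε : ℝ) :
    M.Admissible (M.pulse r j ε) := by
  intro s hs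
  ext k
  have hsr : s ≠ r := fun h => hr (by rw [← h]; exact hs j)
  have : (k = j ∧ s + 1 ≤ r ∧ ∀ r', s + 1 ≤ r' → r' < r → ∀ k, M.χ r' k = 0) ↔
      (k = j ∧ s ≤ r ∧ ∀ r', s ≤ r' → r' < r → ∀ k, M.χ r' k = 0) := by
    refine and_congr_right fun _ => ⟨fun h => ⟨by omega, fun r' h1 h2 => ?_⟩, fun h =>
      ⟨by omega, fun r' h1 h2 => h.2 r' (by omega) h2⟩⟩
    rcases h1.eq_or_lt with rfl | h1
    · exact hs
    · exact h.2 r' h1 h2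
  simp only [pulse, this]

/-- Only step `r` sees the pulse. -/
lemma chi_mul_pulse (r : ℕ) (j : Fin M.m) (ε : ℝ) (s : ℕ) (k : Fin M.m) :
    M.χ s k * M.pulse r j ε s k = if s = r ∧ k = j then M.χ r j * ε else 0 := by
  by_cases h : s = r ∧ k = j
  · obtain ⟨rfl, rfl⟩ := h
    have : M.pulse s k ε s k = ε := by
      rw [pulse, if_pos ⟨rfl, le_rfl, fun r' h1 h2 => by omega⟩]
    rw [this, if_pos ⟨rfl, rfl⟩]
  · rw [if_neg h]
    by_cases hp : k = j ∧ s ≤ r ∧ ∀ r', s ≤ r' → r' < r → ∀ k, M.χ r' k = 0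
    · have hlt : s < r := lt_of_le_of_ne hp.2.1 fun hsr => h ⟨hsr, hp.1⟩
      rw [hp.2.2 s le_rfl hlt, zero_mul]
    · rw [pulse, if_neg hp, mul_zero]

lemma isProfile_pulse (hL : 2 ≤ M.L) {r : ℕ} {j : Fin M.m} (hr : M.χ r j ≠ 0) (ε : ℝ)
    (W : EuclideanSpace ℝ (Fin M.d)) :
    M.IsProfile 1 (fun t i => inner ℝ W (M.ξ i) + ε * (if r < t then
      -(M.η * M.χ r j * inner ℝ (M.ξ j) (M.ξ i) * deriv M.φ (inner ℝ W (M.ξ j))) else 0))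
      (M.pulse r j ε) := by
  refine ⟨fun s hs => ?_, admissible_pulse hr ε, fun _ => ⟨W, fun t i => ?_⟩,
    fun h => absurd hL h⟩
  · have hsr : s ≠ r := fun h => hr (by rw [← h]; exact hs j)
    have : r < s + 1 ↔ r < s := by omega
    ext i
    simp only [this]
  · have e : ∀ (s : Fin t) (k : Fin M.m), M.χ s k * inner ℝ (M.ξ k) (M.ξ i) *
        (M.pulse r j ε s k * deriv M.φ (inner ℝ W (M.ξ k) + ε * (if r < (s : ℕ) then
          -(M.η * M.χ r j * inner ℝ (M.ξ j) (M.ξ k) * deriv M.φ (inner ℝ W (M.ξ j))) else 0))) =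
        if (s : ℕ) = r then (if k = j then
          M.χ r j * ε * inner ℝ (M.ξ j) (M.ξ i) * deriv M.φ (inner ℝ W (M.ξ j)) else 0) else 0 := by
      intro s k
      rw [show ∀ a b c d : ℝ, a * b * (c * d) = a * c * b * d by intros; ring, chi_mul_pulse]
      by_cases hs : (s : ℕ) = r
      · by_cases hk : k = j
        · subst hk; simp [hs]
        · simp [hk]
      · simp [hs]
    simp only [e]
    by_cases hrt : r < t
    · have : ∀ s : Fin t, (s : ℕ) = r ↔ s = ⟨r, hrt⟩ := fun s => by rw [Fin.ext_iff]
      simp only [this, if_pos hrt, Finset.sum_ite_eq', Finset.sum_const_zero, Finset.mem_univ,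
        if_true, Finset.sum_ite_irrel]
      ring
    · have : ∀ s : Fin t, (s : ℕ) ≠ r := fun s => by have := s.2; omega
      simp [this, hrt]

/-- Independence of the derivatives of the first layer features at initialization, weighted by the
derivative at one sample. -/
lemma forall_eq_zero_of_deriv_features (hφ : GoodActivation M.φ) (hξ : GenericInputs M.ξ)
    (j : Fin M.m) (C : Fin M.m → ℝ)
    (h : ∀ W : EuclideanSpace ℝ (Fin M.d), deriv M.φ (inner ℝ W (M.ξ j)) *
      ∑ i, C i * (deriv M.φ (inner ℝ W (M.ξ i))) = 0) (i : Fin M.m) : C i = 0 := by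
  obtain ⟨u, hu0, hu⟩ := hξ.exists_direction
  set β : Fin M.m → ℝ := fun i => inner ℝ u (M.ξ i) with hβ
  have hc := continuous_deriv_of_good hφ
  have h1 : ∀ z : ℝ, deriv M.φ (β j * z) * ∑ i, C i * deriv M.φ (β i * z) = 0 := by
    intro z
    have := h (z • u)
    simpa only [real_inner_smul_left, mul_comm z] using this
  have h2 : (fun z : ℝ => ∑ i, C i * deriv M.φ (β i * z)) = fun _ => 0 := by
    have hcount : {z : ℝ | deriv M.φ (β j * z) = 0}.Countable :=
      (hφ.deriv_level_countable 0).preimage (mul_right_injective₀ (hu0 j))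
    refine Continuous.ext_on (hcount.dense_compl ℝ) (by fun_prop) continuous_const fun z hz => ?_
    exact (mul_eq_zero.mp (h1 z)).resolve_left hz
  have h3 : ∀ z, HasDerivAt (fun z => ∑ i, C i / β i * M.φ (β i * z + 0)) 0 z := by
    intro z
    have e : ∀ i, HasDerivAt (fun z => C i / β i * M.φ (β i * z + 0))
        (C i * deriv M.φ (β i * z)) z := by
      intro i
      have d1 : HasDerivAt (fun z => β i * z + 0) (β i) z := by
        simpa using (hasDerivAt_id z).const_mul (β i)
      have d2 := (differentiable_of_good hφ (β i * z + 0)).hasDerivAt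
      have d3 := (HasDerivAt.comp z d2 d1).const_mul (C i / β i)
      rw [add_zero] at d3
      have hβi : β i ≠ 0 := hu0 i
      have e0 : C i * deriv M.φ (β i * z) = C i / β i * (deriv M.φ (β i * z) * β i) := by
        field_simp
      rw [e0]
      exact d3
    have := HasDerivAt.fun_sum fun i (_ : i ∈ Finset.univ) => e i
    rwa [congrFun h2 z] at this
  have h4 := is_const_of_deriv_eq_zero (fun z => (h3 z).differentiableAt) fun z => (h3 z).deriv
  by_contra hi
  refine hφ.good.comb_not_const M.m (fun i => C i / β i) β 0 ⟨i, ?_⟩ hu ⟨_, fun z => h4 z 0⟩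
  exact mul_ne_zero (div_ne_zero hi (hu0 i)) (hu0 i)

lemma forall_eq_zero_of_features (hφ : GoodActivation M.φ) (hξ : GenericInputs M.ξ)
    (C : Fin M.m → ℝ)
    (h : ∀ W : EuclideanSpace ℝ (Fin M.d), ∑ i, C i * M.φ (inner ℝ W (M.ξ i)) = 0)
    (i : Fin M.m) : C i = 0 := by
  obtain ⟨u, hu0, hu⟩ := hξ.exists_direction
  by_contra hi
  refine hφ.good.comb_not_const M.m C (fun i => inner ℝ u (M.ξ i)) 0
    ⟨i, mul_ne_zero hi (hu0 i)⟩ hu ⟨0, fun z => ?_⟩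
  rw [← h (z • u)]
  simp only [real_inner_smul_left, Pi.zero_apply, add_zero, mul_comm z]

lemma indepX_one (hφ : GoodActivation M.φ) (hξ : GenericInputs M.ξ) (hη : 0 < M.η) (hL : 2 ≤ M.L)
    {n : ℕ} (hDH : ∀ k, n = k + 1 → M.IndepDH 2 k) : M.IndepX 1 n := by
  intro c h0 z hz
  have hprof : ∀ {H D}, M.IsProfile 1 H D → ∑ a, c a * M.φ (H a.1 a.2) = 0 := fun hP =>
    sum_mul_x_profile hφ le_rfl (by omega) (fun h => absurd h (by omega)) (fun _ => hDH) h0 hP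
  have htot : ∀ i, ∑ s, c (s, i) = 0 := by
    refine forall_eq_zero_of_features hφ hξ _ fun W => ?_
    have := hprof (H := fun _ i => inner ℝ W (M.ξ i)) (D := fun _ _ => 0)
      ⟨fun _ _ => rfl, fun _ _ => rfl, fun _ => ⟨W, fun t i => by simp⟩, fun h => absurd hL h⟩
    rw [Fintype.sum_prod_type_right] at this
    simpa only [Finset.sum_mul] using this
  have htail : ∀ r j, M.χ r j ≠ 0 → ∀ i,
      ∑ s : Fin (n + 1), (if r < s then c (s, i) else 0) = 0 := by
    intro r j hr i
    have h1 : ∀ i, (∑ s : Fin (n + 1), if r < s then c (s, i) else 0) *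
        inner ℝ (M.ξ j) (M.ξ i) = 0 := by
      refine forall_eq_zero_of_deriv_features hφ hξ j _ fun W => ?_
      have := sum_mul_deriv_eq_zero (fun a => (differentiable_of_good hφ a).hasDerivAt) c _ _
        fun ε => hprof (isProfile_pulse hL hr ε W)
      rw [Fintype.sum_prod_type_right] at this
      have hne : -(M.η * M.χ r j) ≠ 0 := neg_ne_zero.mpr (mul_ne_zero hη.ne' hr)
      refine mul_left_cancel₀ hne ?_
      rw [mul_zero]
      refine Eq.trans ?_ this
      simp only [Finset.mul_sum, Finset.sum_mul]
      refine Finset.sum_congr rfl fun i _ => Finset.sum_congr rfl fun s _ => ?_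
      split_ifs <;> ring
    have hne : inner ℝ (M.ξ j) (M.ξ i) ≠ 0 := by
      by_cases hji : j = i
      · subst hji
        exact inner_self_ne_zero.mpr fun h => hξ.ne_neg j j (by rw [h, neg_zero])
      · exact abs_ne_zero.mp (hξ.inner_ne_zero j i hji)
    exact (mul_eq_zero.mp (h1 i)).resolve_right hne
  -- Summation by parts: the increments of `z` vanish in the steps without error signal, and the
  -- tails of `c` vanish in the others.
  have hz' : ∀ (s : Fin (n + 1)) i, z s i =
      z 0 i + ∑ r ∈ Finset.range n, if r < (s : ℕ) then z (r + 1) i - z r i else 0 := by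
    intro s i
    have hs := s.2
    rw [← Finset.sum_filter]
    have : (Finset.range n).filter (fun r => r < (s : ℕ)) = Finset.range s := by
      ext r; simp only [Finset.mem_filter, Finset.mem_range]; omega
    rw [this, Finset.sum_range_sub (fun r => z r i)]
    ring
  rw [Fintype.sum_prod_type_right]
  refine Finset.sum_eq_zero fun i _ => ?_
  simp only [hz' _ i, mul_add, Finset.sum_add_distrib, ← Finset.sum_mul, htot i, zero_mul, zero_add,
    Finset.mul_sum]
  rw [Finset.sum_comm]
  refine Finset.sum_eq_zero fun r _ => ?_
  by_cases hr : ∀ j, M.χ r j = 0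
  · simp [hz r hr]
  · obtain ⟨j, hj⟩ := not_forall.mp hr
    have : ∀ s : Fin (n + 1), c (s, i) * (if r < (s : ℕ) then z (r + 1) i - z r i else 0) =
        (if r < (s : ℕ) then c (s, i) else 0) * (z (r + 1) i - z r i) := fun s => by
      split_ifs <;> ring
    simp only [this, ← Finset.sum_mul, htail r j hj i, zero_mul]

/-- At all times and in all layers, the features and the backpropagated vectors satisfy no linear
relations but those imposed by the steps without error signal. -/
lemma indepX_indepDH (hφ : GoodActivation M.φ) (hξ : GenericInputs M.ξ) (hη : 0 < M.η)
    (hL : 2 ≤ M.L) (n : ℕ) : (∀ l, 1 ≤ l → l ≤ M.L → M.IndepX l n) ∧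
      (∀ l, 2 ≤ l → l ≤ M.L → M.IndepDH l n) := by
  induction n using Nat.strong_induction_on with
  | _ n ih =>
    have hX : ∀ l, 1 ≤ l → l ≤ M.L → M.IndepX l n := by
      intro l hl1
      induction l, hl1 using Nat.le_induction with
      | base => exact fun _ => indepX_one hφ hξ hη hL fun k hk =>
          (ih k (by omega)).2 2 le_rfl hL
      | succ l hl1 ihl =>
        intro hlL
        exact indepX_of_two_le hφ (by omega) hlL (by simpa using ihl (by omega)) fun h k hk =>
          (ih k (by omega)).2 _ (by omega) h
    refine ⟨hX, fun l hl2 hlL => ?_⟩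
    induction hk : M.L - l generalizing l with
    | zero =>
      obtain rfl : l = M.L := by omega
      exact indepDH_last hφ hL (hX _ (by omega) (by omega))
    | succ k ihk =>
      exact indepDH_of_lt hφ hl2 (by omega) (hX _ (by omega) (by omega))
        (ihk (l + 1) (by omega) (by omega) (by omega))

/-! ### Stationary weights -/

/-- If the output weight does not change in step `t`, there is no error signal in step `t`. -/
lemma chi_eq_zero_of_ae_outWeight (hφ : GoodActivation M.φ) (hξ : GenericInputs M.ξ)
    (hη : 0 < M.η) (hL : 2 ≤ M.L) {t : ℕ}
    (h : ∀ᵐ ω ∂(M.law M.L (t + 1) (t + 1)), M.outWeight (t + 1) ω = M.outWeight t ω)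
    (i : Fin M.m) : M.χ t i = 0 := by
  have hsum : ∀ᵐ ω ∂(M.law M.L (t + 1) (t + 1)), ∑ j, M.χ t j * M.x M.L t j ω = 0 := by
    filter_upwards [h] with ω hω
    rw [outWeight_eq, outWeight_eq] at hω
    simp only [Fin.sum_univ_castSucc, Fin.val_castSucc, Fin.val_last, mul_add] at hω
    exact (mul_eq_zero.mp (by linarith : M.η * ∑ j, M.χ t j * M.x M.L t j ω = 0)).resolve_left
      hη.ne'
  have hx := continuous_x hφ (M := M)
  have hsum' : ∀ᵐ ω ∂(M.law M.L (t + 1) t), ∑ j, M.χ t j * M.x M.L t j ω = 0 :=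
    ae_law_of_ae_law hφ le_rfl (Nat.le_succ t) (by fun_prop) continuous_const
      (fun ω ω' h1 h2 h3 h4 => Finset.sum_congr rfl fun a _ => by
        rw [M.dependsUpTo_x _ _ _ ω ω' h1 h2 h3 h4])
      (fun _ _ _ _ _ _ => rfl) hsum
  have h1 := ((indepX_indepDH hφ hξ hη hL t).1 M.L (by omega) le_rfl)
    (fun a => if a.1 = Fin.last t then M.χ t a.2 else 0) (by
      filter_upwards [hsum'] with ω hω
      rw [Fintype.sum_prod_type, Finset.sum_eq_single (Fin.last t)]
      · simpa using hω
      · intro s _ hs; simp [hs]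
      · simp) (fun _ i => M.χ t i) (fun _ _ => rfl)
  rw [Fintype.sum_prod_type, Finset.sum_eq_single (Fin.last t)] at h1
  · simp only [if_true] at h1
    have := (Finset.sum_eq_zero_iff_of_nonneg fun j _ => mul_self_nonneg (M.χ t j)).mp h1 i
      (Finset.mem_univ i)
    exact mul_self_eq_zero.mp this
  · intro s _ hs; simp [hs]
  · simp

lemma f_succ_of_stall (hφ : GoodActivation M.φ) {t : ℕ} (hχ : ∀ j, M.χ t j = 0) (i : Fin M.m) :
    M.f (t + 1) i = M.f t i := by
  rw [f_succ, add_eq_left]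
  refine integral_eq_zero_of_ae ?_
  filter_upwards [ae_x_succ_of_stall hφ (l := M.L) (q := t + 1) hχ le_rfl] with ω hω
  have : M.outWeight (t + 1) ω = M.outWeight t ω := by
    rw [outWeight_eq, outWeight_eq]
    simp only [Fin.sum_univ_castSucc, Fin.val_castSucc, Fin.val_last, hχ, zero_mul, add_zero,
      Finset.sum_const_zero]
  simp [this, hω]

end MLPTraining

lemma ConvexOn.isMinOn_univ_of_deriv_eq_zero {g : ℝ → ℝ} (hg : ConvexOn ℝ Set.univ g) {a : ℝ}
    (hd : DifferentiableAt ℝ g a) (h0 : deriv g a = 0) (z : ℝ) : g a ≤ g z := by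
  have h := hg.isMinOn_of_rightDeriv_eq_zero (x := a) (by simp)
    (by rw [hd.derivWithin (uniqueDiffWithinAt_Ioi a), h0])
  exact h (Set.mem_univ z)

theorem corollary1 (M : MLPTraining) (hL : 1 < M.L) (hη : 0 < M.η)
    (hloss : ∀ v : ℝ, ContDiff ℝ 1 (fun z => M.loss z v))
    (hξ : GenericInputs M.ξ) (hφ : GoodActivation M.φ)
    (T : ℕ) (hT : M.WeightsConstantFrom T) :
    ∀ i : Fin M.m, (∃ t, T ≤ t ∧ i ∈ M.batch t) →
      M.χ T i = 0 ∧
      deriv (fun z => M.loss z (M.y i)) (M.f T i) = 0 ∧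
      (∀ t, T ≤ t → M.χ t i = 0) ∧
      (ConvexOn ℝ Set.univ (fun z => M.loss z (M.y i)) →
        ∀ z : ℝ, M.loss (M.f T i) (M.y i) ≤ M.loss z (M.y i)) := by
  have hχ : ∀ t, T ≤ t → ∀ i, M.χ t i = 0 := by
    intro t ht
    refine M.chi_eq_zero_of_ae_outWeight hφ hξ hη hL ?_
    have h1 := (hT (t + 1) (by omega)).2.2
    have h2 := MLPTraining.ae_law_mono hφ (Nat.le_succ t) (Nat.le_succ t)
      (M.dependsUpTo_outWeight t) ((M.dependsUpTo_outWeight T).mono ht ht) (hT t ht).2.2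
    filter_upwards [h1, h2] with ω e1 e2
    rw [e1, e2]
  have hf : ∀ t, T ≤ t → ∀ i, M.f t i = M.f T i := by
    intro t ht i
    induction t, ht using Nat.le_induction with
    | base => rfl
    | succ t ht ih => rw [MLPTraining.f_succ_of_stall hφ (hχ t ht), ih]
  rintro i ⟨t, ht, hi⟩
  have hd : deriv (fun z => M.loss z (M.y i)) (M.f T i) = 0 := by
    have := hχ t ht i
    rwa [MLPTraining.χ, if_pos hi, hf t ht] at this
  exact ⟨hχ T le_rfl i, hd, fun t ht => hχ t ht i, fun hc =>
    hc.isMinOn_univ_of_deriv_eq_zero ((hloss _).differentiable (by norm_num) _) hd⟩
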